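/- **Setting.** Let $\widehat{\mathfrak g}$ be the complex affine Kac–Moody algebra of type $X_N^{(k)}$ (in the notation of Kac's tables), with Cartan subalgebra $\widehat{\mathfrak h}$, generalized Cartan matrix $(a_{ij})_{0\le i,j\le n}$, $a_{ij}=\langle\alpha_i^\vee,\alpha_j\rangle$, simple roots $\alpha_0,\dots,\alpha_n$, labels $a_0,\dots,a_n$ (the coprime positive integers with $\sum_j a_{ij}a_j=0$ for all $i$), dual labels $a_0^\vee,\dots,a_n^\vee$ (the coprime positive integers with $\sum_i a_i^\vee a_{ij}=0$ for all $j$), $\delta=\sum_i a_i\alpha_i$, set of roots $\widehat\Delta$, set of positive roots $\widehat\Delta^+$ and Weyl group $\widehat W$. A root is real if it is $\widehat W$-conjugate to a simple root. Let $\widehat{\mathfrak h}_{\mathbb R}^*$ be the real vector space with basis $\alpha_0,\dots,\alpha_n,\omega_0$, and let $(\ ,\ )$ be the normalized standard symmetric form on it: $(\alpha_i,\alpha_j)=\frac{a_i^\vee}{a_i}a_{ij}$, $(\alpha_0,\omega_0)=\frac1{a_0}$, $(\alpha_i,\omega_0)=0$ for $i\neq0$, $(\omega_0,\omega_0)=0$.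 A long root is a real root $\alpha$ for which $(\alpha,\alpha)$ is maximal among the real roots (so all real roots are long if they all have the same length). Since $(\alpha,\delta)=0$ for every $\alpha\in\widehat\Delta$, the half-space $$\widehat H_\alpha^+=\{x\in\widehat{\mathfrak h}_{\mathbb R}^*/\mathbb R\delta \mid (\alpha,x)\ge 0\}$$ is well defined. Let $\sigma$ be an involution of type $(s_0,\dots,s_n;k)$, i.e. $s_0,\dots,s_n$ are coprime non-negative integers with $k\sum_{i=0}^n a_is_i=2$. For $\alpha=\sum_i m_i\alpha_i$ put $ht_\sigma(\alpha)=\sum_i s_im_i$, and let $\widehat\Delta_0^+=\{\alpha\in\widehat\Delta^+\mid ht_\sigma(\alpha)=0\}$. Let $\widehat\Delta_0^{max}$ be the set of maximal elements of $\widehat\Delta_0^+$ for the order in which $\alpha\le\beta$ if and only if $\beta-\alpha$ is a (possibly empty) sum of elements of $\widehat\Delta_0^+$. Put $\epsilon_i=1$ if $k=1$ or $\alpha_i$ is not a long root, and $\epsilon_i=2$ if $k=2$ and $\alpha_i$ is a long root. Define $$\Phi_\sigma=\{\alpha_i+\epsilon_is_i\delta\mid i=0,\dots,n\}\cup\{k\delta-\gamma\mid\gamma\in\widehat\Delta_0^{max}\},\qquad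 C_\sigma=\bigcap_{\alpha\in\widehat\Delta^+,\ ht_\sigma(\alpha)\ne1}\widehat H_\alpha^+ .$$ **Proposition 4.1.** We have $\Phi_\sigma\subset\widehat\Delta^+$ and $$C_\sigma=\bigcap_{\alpha\in\Phi_\sigma}\widehat H_\alpha^+ .$$ -/

import Mathlib

/-- The affine diagrams `X_N^{(k)}`, in the order of Kac's tables Aff 1, Aff 2, Aff 3. -/
inductive AffineType
  /-- `A_1^{(1)}` -/
  | A1
  /-- `A_l^{(1)}`, `l ≥ 2` -/
  | A (l : ℕ) (hl : 2 ≤ l)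
  /-- `B_l^{(1)}`, `l ≥ 3` -/
  | B (l : ℕ) (hl : 3 ≤ l)
  /-- `C_l^{(1)}`, `l ≥ 2` -/
  | C (l : ℕ) (hl : 2 ≤ l)
  /-- `D_l^{(1)}`, `l ≥ 4` -/
  | D (l : ℕ) (hl : 4 ≤ l)
  /-- `E_6^{(1)}` -/
  | E6
  /-- `E_7^{(1)}` -/
  | E7
  /-- `E_8^{(1)}` -/
  | E8
  /-- `F_4^{(1)}` -/
  | F4
  /-- `G_2^{(1)}` -/
  | G2
  /-- `A_2^{(2)}` -/
  | twA2
  /-- `A_{2l}^{(2)}`, `l ≥ 2` -/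
  | twAeven (l : ℕ) (hl : 2 ≤ l)
  /-- `A_{2l-1}^{(2)}`, `l ≥ 3` -/
  | twAodd (l : ℕ) (hl : 3 ≤ l)
  /-- `D_{l+1}^{(2)}`, `l ≥ 2` -/
  | twD (l : ℕ) (hl : 2 ≤ l)
  /-- `E_6^{(2)}` -/
  | twE6
  /-- `D_4^{(3)}` -/
  | twD4

namespace AffineType

/-- The number `n`, where the simple roots are `α_0, …, α_n`. -/
def rank : AffineType → ℕ
  | A1 => 1
  | A l _ => l
  | B l _ => l
  | C l _ => l
  | D l _ => l
  | E6 => 6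
  | E7 => 7
  | E8 => 8
  | F4 => 4
  | G2 => 2
  | twA2 => 1
  | twAeven l _ => l
  | twAodd l _ => l
  | twD l _ => l
  | twE6 => 4
  | twD4 => 2

/-- The superscript `k` in `X_N^{(k)}`. -/
def k : AffineType → ℕ
  | A1 | A _ _ | B _ _ | C _ _ | D _ _ | E6 | E7 | E8 | F4 | G2 => 1
  | twA2 | twAeven _ _ | twAodd _ _ | twD _ _ | twE6 => 2
  | twD4 => 3

/-- The vertices `0, …, n` of the diagram. -/
abbrev Vertex (T : AffineType) : Type := Fin (T.rank + 1)

/-- The generalized Cartan matrix `a_{ij} = ⟨α_i^∨, α_j⟩`, in Kac's numbering. -/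
def cartan : (T : AffineType) → Matrix T.Vertex T.Vertex ℤ
  | A1 => (!![2, -2; -2, 2] : Matrix (Fin 2) (Fin 2) ℤ)
  | A l _ => fun i j : Fin (l + 1) =>
      -- the cycle `0 - 1 - ⋯ - l - 0`
      if i = j then 2
      else if i.val + 1 = j.val ∨ j.val + 1 = i.val then -1
      else if (i.val = 0 ∧ j.val = l) ∨ (i.val = l ∧ j.val = 0) then -1
      else 0
  | B l _ => fun i j : Fin (l + 1) =>
      -- `0` and `1` joined to `2`; then `2 - ⋯ - (l-1) ⇒ l`, with `α_l` short
      if i = j then 2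
      else if i.val = l ∧ j.val + 1 = l then -2
      else if i.val ≠ 0 ∧ j.val ≠ 0 ∧ (i.val + 1 = j.val ∨ j.val + 1 = i.val) then -1
      else if (i.val = 0 ∧ j.val = 2) ∨ (i.val = 2 ∧ j.val = 0) then -1
      else 0
  | C l _ => fun i j : Fin (l + 1) =>
      -- `0 ⇒ 1 - ⋯ - (l-1) ⇐ l`, with `α_0` and `α_l` long
      if i = j then 2
      else if i.val = 1 ∧ j.val = 0 then -2
      else if i.val + 1 = l ∧ j.val = l then -2
      else if i.val + 1 = j.val ∨ j.val + 1 = i.val then -1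
      else 0
  | D l _ => fun i j : Fin (l + 1) =>
      -- `0` and `1` joined to `2`; `2 - ⋯ - (l-2)`; `l-1` and `l` joined to `l-2`
      if i = j then 2
      else if i.val ≠ 0 ∧ j.val ≠ 0 ∧ i.val ≠ l ∧ j.val ≠ l ∧
          (i.val + 1 = j.val ∨ j.val + 1 = i.val) then -1
      else if (i.val = 0 ∧ j.val = 2) ∨ (i.val = 2 ∧ j.val = 0) then -1
      else if (i.val + 2 = l ∧ j.val = l) ∨ (i.val = l ∧ j.val + 2 = l) then -1
      else 0
  | E6 => (!![ 2,  0,  0,  0,  0,  0, -1;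
               0,  2, -1,  0,  0,  0,  0;
               0, -1,  2, -1,  0,  0,  0;
               0,  0, -1,  2, -1,  0, -1;
               0,  0,  0, -1,  2, -1,  0;
               0,  0,  0,  0, -1,  2,  0;
              -1,  0,  0, -1,  0,  0,  2] : Matrix (Fin 7) (Fin 7) ℤ)
  | E7 => (!![ 2, -1,  0,  0,  0,  0,  0,  0;
              -1,  2, -1,  0,  0,  0,  0,  0;
               0, -1,  2, -1,  0,  0,  0,  0;
               0,  0, -1,  2, -1,  0,  0, -1;
               0,  0,  0, -1,  2, -1,  0,  0;
               0,  0,  0,  0, -1,  2, -1,  0;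
               0,  0,  0,  0,  0, -1,  2,  0;
               0,  0,  0, -1,  0,  0,  0,  2] : Matrix (Fin 8) (Fin 8) ℤ)
  | E8 => (!![ 2, -1,  0,  0,  0,  0,  0,  0,  0;
              -1,  2, -1,  0,  0,  0,  0,  0,  0;
               0, -1,  2, -1,  0,  0,  0,  0,  0;
               0,  0, -1,  2, -1,  0,  0,  0,  0;
               0,  0,  0, -1,  2, -1,  0,  0,  0;
               0,  0,  0,  0, -1,  2, -1,  0, -1;
               0,  0,  0,  0,  0, -1,  2, -1,  0;
               0,  0,  0,  0,  0,  0, -1,  2,  0;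
               0,  0,  0,  0,  0, -1,  0,  0,  2] : Matrix (Fin 9) (Fin 9) ℤ)
  | F4 => -- `0 - 1 - 2 ⇒ 3 - 4`, with `α_3`, `α_4` short
          (!![ 2, -1,  0,  0,  0;
              -1,  2, -1,  0,  0;
               0, -1,  2, -1,  0;
               0,  0, -2,  2, -1;
               0,  0,  0, -1,  2] : Matrix (Fin 5) (Fin 5) ℤ)
  | G2 => -- `0 - 1 ⇛ 2`, with `α_2` short
          (!![ 2, -1,  0;
              -1,  2, -1;
               0, -3,  2] : Matrix (Fin 3) (Fin 3) ℤ)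
  | twA2 => (!![2, -4; -1, 2] : Matrix (Fin 2) (Fin 2) ℤ)
  | twAeven l _ => fun i j : Fin (l + 1) =>
      -- `0 ⇐ 1 - ⋯ - (l-1) ⇐ l`, with `α_0` shortest and `α_l` longest
      if i = j then 2
      else if i.val = 0 ∧ j.val = 1 then -2
      else if i.val + 1 = l ∧ j.val = l then -2
      else if i.val + 1 = j.val ∨ j.val + 1 = i.val then -1
      else 0
  | twAodd l _ => fun i j : Fin (l + 1) =>
      -- `0` and `1` joined to `2`; then `2 - ⋯ - (l-1) ⇐ l`, with `α_l` long
      if i = j then 2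
      else if i.val + 1 = l ∧ j.val = l then -2
      else if i.val ≠ 0 ∧ j.val ≠ 0 ∧ (i.val + 1 = j.val ∨ j.val + 1 = i.val) then -1
      else if (i.val = 0 ∧ j.val = 2) ∨ (i.val = 2 ∧ j.val = 0) then -1
      else 0
  | twD l _ => fun i j : Fin (l + 1) =>
      -- `0 ⇐ 1 - ⋯ - (l-1) ⇒ l`, with `α_0` and `α_l` short
      if i = j then 2
      else if i.val = 0 ∧ j.val = 1 then -2
      else if i.val = l ∧ j.val + 1 = l then -2
      else if i.val + 1 = j.val ∨ j.val + 1 = i.val then -1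
      else 0
  | twE6 => -- `0 - 1 - 2 ⇐ 3 - 4`, with `α_3`, `α_4` long
          (!![ 2, -1,  0,  0,  0;
              -1,  2, -1,  0,  0;
               0, -1,  2, -2,  0;
               0,  0, -1,  2, -1;
               0,  0,  0, -1,  2] : Matrix (Fin 5) (Fin 5) ℤ)
  | twD4 => -- `0 - 1 ⇚ 2`, with `α_2` long
          (!![ 2, -1,  0;
              -1,  2, -3;
               0, -1,  2] : Matrix (Fin 3) (Fin 3) ℤ)

/-- The labels `a_0, …, a_n`: the coprime positive integers with `∑_j a_{ij} a_j = 0`. -/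
def label : (T : AffineType) → T.Vertex → ℕ
  | A1 => (![1, 1] : Fin 2 → ℕ)
  | A l _ => fun _ : Fin (l + 1) => 1
  | B l _ => fun i : Fin (l + 1) => if i.val ≤ 1 then 1 else 2
  | C l _ => fun i : Fin (l + 1) => if i.val = 0 ∨ i.val = l then 1 else 2
  | D l _ => fun i : Fin (l + 1) => if i.val ≤ 1 ∨ l ≤ i.val + 1 then 1 else 2
  | E6 => (![1, 1, 2, 3, 2, 1, 2] : Fin 7 → ℕ)
  | E7 => (![1, 2, 3, 4, 3, 2, 1, 2] : Fin 8 → ℕ)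
  | E8 => (![1, 2, 3, 4, 5, 6, 4, 2, 3] : Fin 9 → ℕ)
  | F4 => (![1, 2, 3, 4, 2] : Fin 5 → ℕ)
  | G2 => (![1, 2, 3] : Fin 3 → ℕ)
  | twA2 => (![2, 1] : Fin 2 → ℕ)
  | twAeven l _ => fun i : Fin (l + 1) => if i.val = l then 1 else 2
  | twAodd l _ => fun i : Fin (l + 1) => if i.val ≤ 1 ∨ i.val = l then 1 else 2
  | twD l _ => fun _ : Fin (l + 1) => 1
  | twE6 => (![1, 2, 3, 2, 1] : Fin 5 → ℕ)
  | twD4 => (![1, 2, 1] : Fin 3 → ℕ)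

/-- The dual labels `a_0^∨, …, a_n^∨`: the coprime positive integers with
`∑_i a_i^∨ a_{ij} = 0`. -/
def colabel : (T : AffineType) → T.Vertex → ℕ
  | A1 => (![1, 1] : Fin 2 → ℕ)
  | A l _ => fun _ : Fin (l + 1) => 1
  | B l _ => fun i : Fin (l + 1) => if i.val ≤ 1 ∨ i.val = l then 1 else 2
  | C l _ => fun _ : Fin (l + 1) => 1
  | D l _ => fun i : Fin (l + 1) => if i.val ≤ 1 ∨ l ≤ i.val + 1 then 1 else 2
  | E6 => (![1, 1, 2, 3, 2, 1, 2] : Fin 7 → ℕ)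
  | E7 => (![1, 2, 3, 4, 3, 2, 1, 2] : Fin 8 → ℕ)
  | E8 => (![1, 2, 3, 4, 5, 6, 4, 2, 3] : Fin 9 → ℕ)
  | F4 => (![1, 2, 3, 2, 1] : Fin 5 → ℕ)
  | G2 => (![1, 2, 1] : Fin 3 → ℕ)
  | twA2 => (![1, 2] : Fin 2 → ℕ)
  | twAeven l _ => fun i : Fin (l + 1) => if i.val = 0 then 1 else 2
  | twAodd l _ => fun i : Fin (l + 1) => if i.val ≤ 1 then 1 else 2
  | twD l _ => fun i : Fin (l + 1) => if i.val = 0 ∨ i.val = l then 1 else 2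
  | twE6 => (![1, 2, 3, 4, 2] : Fin 5 → ℕ)
  | twD4 => (![1, 2, 3] : Fin 3 → ℕ)

theorem cartan_diag (T : AffineType) (i : T.Vertex) : T.cartan i i = 2 := by
  cases T <;> first | (revert i; decide) | exact if_pos rfl

theorem sum_ite_val_eq (l m : ℕ) (c : ℤ) :
    ∑ j : Fin (l + 1), (if j.val = m then c else 0) = if m ≤ l then c else 0 := by
  rw [Fin.sum_univ_eq_sum_range (fun j => if j = m then c else 0) (l + 1)]
  simp [Finset.sum_ite_eq']

theorem sum_eq_zero_of_support {l : ℕ} (f : Fin (l + 1) → ℤ) (p₁ p₂ p₃ p₄ p₅ : ℕ)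
    (c₁ c₂ c₃ c₄ c₅ : ℤ)
    (key : ∀ j : Fin (l + 1), f j = (if j.val = p₁ then c₁ else 0) +
      (if j.val = p₂ then c₂ else 0) + (if j.val = p₃ then c₃ else 0) +
      (if j.val = p₄ then c₄ else 0) + (if j.val = p₅ then c₅ else 0))
    (h : (if p₁ ≤ l then c₁ else 0) + (if p₂ ≤ l then c₂ else 0) + (if p₃ ≤ l then c₃ else 0) +
      (if p₄ ≤ l then c₄ else 0) + (if p₅ ≤ l then c₅ else 0) = 0) :
    ∑ j, f j = 0 := by
  simp only [key, Finset.sum_add_distrib, sum_ite_val_eq, h]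

/-- The labels span the kernel: `∑_j a_{ij} a_j = 0`. -/
theorem sum_cartan_mul_label (T : AffineType) (i : T.Vertex) :
    ∑ j, T.cartan i j * (T.label j : ℤ) = 0 := by
  cases T
  case A l hl =>
    change Fin (l + 1) at i
    have hi := i.2
    refine sum_eq_zero_of_support (l := l) _ i (i + 1) (i - 1) 0 l
      2 (-1) (if i.val = 0 then 0 else -1) (if i.val = l then -1 else 0)
      (if i.val = 0 then -1 else 0) (fun j => ?_) (by grind (splits := 40))
    have hj := j.2
    simp only [cartan, label, Fin.ext_iff]
    grind (splits := 40)
  case B l hl =>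
    change Fin (l + 1) at i
    have hi := i.2
    refine sum_eq_zero_of_support (l := l) _ i (i + 1) (i - 1) (i + 2) (i - 2)
      (if i.val ≤ 1 then 2 else 4) (if i.val = 0 then 0 else -2)
      (if i.val ≤ 1 then 0 else if i.val = 2 then -1 else if i.val = l then -4 else -2)
      (if i.val = 0 then -2 else 0) (if i.val = 2 then -1 else 0) (fun j => ?_) (by grind (splits := 40))
    have hj := j.2
    simp only [cartan, label, Fin.ext_iff]
    grind (splits := 40)
  case C l hl =>
    change Fin (l + 1) at i
    have hi := i.2
    refine sum_eq_zero_of_support (l := l) _ i (i + 1) (i - 1) 0 0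
      (if i.val = 0 ∨ i.val = l then 2 else 4) (-2) (if i.val = 0 then 0 else -2) 0 0
      (fun j => ?_) (by grind (splits := 40))
    have hj := j.2
    simp only [cartan, label, Fin.ext_iff]
    grind (splits := 40)
  case D l hl =>
    change Fin (l + 1) at i
    have hi := i.2
    refine sum_eq_zero_of_support (l := l) _ i (i + 1) (i - 1) (i + 2) (i - 2)
      (if i.val ≤ 1 ∨ l ≤ i.val + 1 then 2 else 4)
      (if i.val = 0 then 0 else if l ≤ i.val + 1 then 0 else if l = i.val + 2 then -1 else -2)
      (if i.val ≤ 1 then 0 else if i.val = 2 then -1 else if i.val = l then 0 else -2)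
      (if i.val = 0 then -2 else if i.val + 2 = l then -1 else 0)
      (if i.val = 2 then -1 else if i.val = l then -2 else 0) (fun j => ?_) (by grind (splits := 40))
    have hj := j.2
    simp only [cartan, label, Fin.ext_iff]
    grind (splits := 40)
  case twAeven l hl =>
    change Fin (l + 1) at i
    have hi := i.2
    refine sum_eq_zero_of_support (l := l) _ i (i + 1) (i - 1) 0 0
      (if i.val = l then 2 else 4) (if i.val = 0 then -4 else -2)
      (if i.val = 0 then 0 else -2) 0 0 (fun j => ?_) (by grind (splits := 40))
    have hj := j.2
    simp only [cartan, label, Fin.ext_iff]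
    grind (splits := 40)
  case twAodd l hl =>
    change Fin (l + 1) at i
    have hi := i.2
    refine sum_eq_zero_of_support (l := l) _ i (i + 1) (i - 1) (i + 2) (i - 2)
      (if i.val ≤ 1 ∨ i.val = l then 2 else 4) (if i.val = 0 then 0 else -2)
      (if i.val ≤ 1 then 0 else if i.val = 2 then -1 else -2)
      (if i.val = 0 then -2 else 0) (if i.val = 2 then -1 else 0) (fun j => ?_) (by grind (splits := 40))
    have hj := j.2
    simp only [cartan, label, Fin.ext_iff]
    grind (splits := 40)
  case twD l hl =>
    change Fin (l + 1) at i
    have hi := i.2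
    refine sum_eq_zero_of_support (l := l) _ i (i + 1) (i - 1) 0 0
      2 (if i.val = 0 then -2 else -1)
      (if i.val = 0 then 0 else if i.val = l then -2 else -1) 0 0 (fun j => ?_) (by grind (splits := 40))
    have hj := j.2
    simp only [cartan, label, Fin.ext_iff]
    grind (splits := 40)
  all_goals (revert i; decide)

/-! ### The affine Kac–Moody algebra and its roots -/

/-- Generators: Chevalley generators `e_i`, `f_i`, and the basis `α_0^∨, …, α_n^∨, d` of the
Cartan subalgebra. -/
inductive Gen (T : AffineType)
  | e (i : T.Vertex)
  | f (i : T.Vertex)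
  | h (i : T.Vertex)
  | d

/-- The free generator attached to `x`. -/
noncomputable abbrev free (T : AffineType) (x : T.Gen) : FreeLieAlgebra ℂ T.Gen :=
  FreeLieAlgebra.of ℂ x

/-- Defining relations. The realization is `⟨α_j, α_i^∨⟩ = a_{ij}`, `⟨α_0, d⟩ = 1` and
`⟨α_j, d⟩ = 0` for `j ≠ 0`. -/
inductive Relation (T : AffineType) : FreeLieAlgebra ℂ T.Gen → Prop
  | hh (i j : T.Vertex) : T.Relation ⁅T.free (.h i), T.free (.h j)⁆
  | dh (i : T.Vertex) : T.Relation ⁅T.free .d, T.free (.h i)⁆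
  | he (i j : T.Vertex) : T.Relation
      (⁅T.free (.h i), T.free (.e j)⁆
        - (T.cartan i j : ℂ) • T.free (.e j))
  | hf (i j : T.Vertex) : T.Relation
      (⁅T.free (.h i), T.free (.f j)⁆
        + (T.cartan i j : ℂ) • T.free (.f j))
  | de (j : T.Vertex) : T.Relation
      (⁅T.free .d, T.free (.e j)⁆
        - (if j = 0 then (1 : ℂ) else 0) • T.free (.e j))
  | df (j : T.Vertex) : T.Relation
      (⁅T.free .d, T.free (.f j)⁆
        + (if j = 0 then (1 : ℂ) else 0) • T.free (.f j))
  | ef_same (i : T.Vertex) : T.Relation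
      (⁅T.free (.e i), T.free (.f i)⁆ - T.free (.h i))
  | ef_ne (i j : T.Vertex) (hij : i ≠ j) : T.Relation
      ⁅T.free (.e i), T.free (.f j)⁆
  | serre_e (i j : T.Vertex) (hij : i ≠ j) : T.Relation
      (((LieAlgebra.ad ℂ (FreeLieAlgebra ℂ T.Gen) (T.free (.e i)))
        ^ (1 - T.cartan i j).toNat) (T.free (.e j)))
  | serre_f (i j : T.Vertex) (hij : i ≠ j) : T.Relation
      (((LieAlgebra.ad ℂ (FreeLieAlgebra ℂ T.Gen) (T.free (.f i)))
        ^ (1 - T.cartan i j).toNat) (T.free (.f j)))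

/-- The ideal generated by the defining relations. -/
noncomputable def relationIdeal (T : AffineType) : LieIdeal ℂ (FreeLieAlgebra ℂ T.Gen) :=
  LieSubmodule.lieSpan ℂ (FreeLieAlgebra ℂ T.Gen) {x | T.Relation x}

/-- The affine Kac–Moody algebra `ĝ` of type `X_N^{(k)}`, presented by Chevalley generators, an
`(n+2)`-dimensional Cartan subalgebra, and Serre relations. -/
abbrev KacMoody (T : AffineType) : Type :=
  FreeLieAlgebra ℂ T.Gen ⧸ T.relationIdeal

/-- The image of a generator in `ĝ`. -/
noncomputable def gen (T : AffineType) (x : T.Gen) : T.KacMoody :=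
  LieSubmodule.Quotient.mk (T.free x)

/-- The root lattice `⨁ ℤ α_i`; `m` stands for `∑ m_i α_i`. -/
abbrev RootLattice (T : AffineType) : Type := T.Vertex → ℤ

/-- The simple root `α_i`. -/
def simpleRoot (T : AffineType) (i : T.Vertex) : T.RootLattice := Pi.single i 1

/-- `δ = ∑ a_i α_i`. -/
def delta (T : AffineType) : T.RootLattice := fun i => (T.label i : ℤ)

/-- The evaluation `m ↦ ⟨m, α_i^∨⟩ = ∑_j a_{ij} m_j`. -/
def coroot (T : AffineType) (i : T.Vertex) : T.RootLattice →ₗ[ℤ] ℤ :=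
  ∑ j, T.cartan i j • LinearMap.proj j

/-- The weight space `ĝ_m = {x | [h, x] = ⟨m, h⟩ x for all h in the Cartan subalgebra}`. -/
def rootSpace (T : AffineType) (m : T.RootLattice) : Set T.KacMoody :=
  {x | (∀ i, ⁅T.gen (Gen.h i), x⁆ = ((T.coroot i m : ℤ) : ℂ) • x) ∧
    ⁅T.gen Gen.d, x⁆ = ((m 0 : ℤ) : ℂ) • x}

/-- The set of roots `Δ̂` of `ĝ`. -/
def roots (T : AffineType) : Set T.RootLattice :=
  {m | m ≠ 0 ∧ ∃ x ∈ T.rootSpace m, x ≠ 0}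

/-- The set of positive roots `Δ̂⁺`. -/
def posRoots (T : AffineType) : Set T.RootLattice :=
  {m | m ∈ T.roots ∧ ∀ i, 0 ≤ m i}

theorem coroot_simpleRoot_self (T : AffineType) (i : T.Vertex) :
    T.coroot i (T.simpleRoot i) = 2 := by
  simp [coroot, simpleRoot, Pi.single_apply, T.cartan_diag]

/-- The simple reflection `m ↦ m - ⟨m, α_i^∨⟩ α_i`. -/
def simpleReflection (T : AffineType) (i : T.Vertex) : T.RootLattice ≃ₗ[ℤ] T.RootLattice :=
  Module.reflection (T.coroot_simpleRoot_self i)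

/-- The affine Weyl group `Ŵ`, acting on the root lattice. -/
def weylGroup (T : AffineType) : Subgroup (T.RootLattice ≃ₗ[ℤ] T.RootLattice) :=
  Subgroup.closure (Set.range T.simpleReflection)

/-- The real roots: those conjugate to a simple root under the Weyl group. -/
def realRoots (T : AffineType) : Set T.RootLattice :=
  {m | m ∈ T.roots ∧ ∃ w ∈ T.weylGroup, ∃ i, m = w (T.simpleRoot i)}

/-! ### The space `ĥ_ℝ^*` and its standard form -/

/-- `ĥ_ℝ^*`: the pair `(x, c)` stands for `∑ x_i α_i + c ω_0`. -/
abbrev HDual (T : AffineType) : Type := (T.Vertex → ℝ) × ℝ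

/-- The normalized standard form: `(α_i, α_j) = (a_i^∨ / a_i) a_{ij}`, `(α_0, ω_0) = 1 / a_0`,
`(α_i, ω_0) = 0` for `i ≠ 0`, and `(ω_0, ω_0) = 0`. -/
noncomputable def form (T : AffineType) : LinearMap.BilinForm ℝ T.HDual :=
  LinearMap.mk₂ ℝ
    (fun x y => (∑ i, ∑ j, x.1 i * ((T.colabel i : ℝ) / (T.label i : ℝ)) *
        ((T.cartan i j : ℝ) * y.1 j)) + (x.1 0 * y.2 + x.2 * y.1 0) / (T.label 0 : ℝ))
    (fun x x' y => by
      simp only [Prod.fst_add, Prod.snd_add, Pi.add_apply, add_mul, Finset.sum_add_distrib]; ring)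
    (fun c x y => by
      simp only [Prod.smul_fst, Prod.smul_snd, Pi.smul_apply, smul_eq_mul, mul_add,
        Finset.mul_sum]
      congr 1
      · exact Finset.sum_congr rfl fun i _ => Finset.sum_congr rfl fun j _ => by ring
      · ring)
    (fun x y y' => by
      simp only [Prod.fst_add, Prod.snd_add, Pi.add_apply, mul_add, Finset.sum_add_distrib]; ring)
    (fun c x y => by
      simp only [Prod.smul_fst, Prod.smul_snd, Pi.smul_apply, smul_eq_mul, mul_add,
        Finset.mul_sum]
      congr 1
      · exact Finset.sum_congr rfl fun i _ => Finset.sum_congr rfl fun j _ => by ring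
      · ring)

/-- The inclusion of the root lattice in `ĥ_ℝ^*`. -/
def toHDual (T : AffineType) (m : T.RootLattice) : T.HDual := (fun i => (m i : ℝ), 0)

/-- `ĥ_0^* = {x ∈ ĥ_ℝ^* | (x, δ) = 0}`. -/
noncomputable def hZero (T : AffineType) : Submodule ℝ T.HDual :=
  LinearMap.ker (T.form.flip (T.toHDual T.delta))

theorem toHDual_mem_hZero (T : AffineType) (m : T.RootLattice) : T.toHDual m ∈ T.hZero := by
  have key : ∀ i, ∑ j, (T.cartan i j : ℝ) * (T.label j : ℝ) = 0 := fun i => by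
    exact_mod_cast T.sum_cartan_mul_label i
  simp [hZero, form, toHDual, delta, ← Finset.mul_sum, key]

/-- The quotient `ĥ_ℝ^* / ℝδ`. -/
abbrev HBar (T : AffineType) : Type :=
  T.HDual ⧸ Submodule.span ℝ {T.toHDual T.delta}

/-- The pairing `(α, λ + ℝδ) = (α, λ)` between `ĥ_0^*` and `ĥ_ℝ^* / ℝδ`. -/
noncomputable def pairing (T : AffineType) (a : T.hZero) : T.HBar →ₗ[ℝ] ℝ :=
  Submodule.liftQ _ (T.form a) (by
    rw [Submodule.span_singleton_le_iff_mem]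
    exact a.2)

/-- The closed half-space `Ĥ_α⁺ = {x ∈ ĥ_ℝ^* / ℝδ | (α, x) ≥ 0}`. -/
noncomputable def halfSpace (T : AffineType) (m : T.RootLattice) : Set T.HBar :=
  {x | 0 ≤ T.pairing ⟨T.toHDual m, T.toHDual_mem_hZero m⟩ x}

/-- The long roots: the real roots of maximal length. -/
def longRoots (T : AffineType) : Set T.RootLattice :=
  {m | m ∈ T.realRoots ∧ ∀ b ∈ T.realRoots,
    T.form (T.toHDual b) (T.toHDual b) ≤ T.form (T.toHDual m) (T.toHDual m)}

/-! ### The objects attached to an involution of type `(s_0, …, s_n; k)` -/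

/-- The `σ`-height `ht_σ(∑ m_i α_i) = ∑ s_i m_i`. -/
def htSigma (T : AffineType) (s : T.Vertex → ℕ) (m : T.RootLattice) : ℤ :=
  ∑ i, (s i : ℤ) * m i

/-- `Δ̂_0⁺`, the positive roots of `σ`-height zero. -/
def posRootsZero (T : AffineType) (s : T.Vertex → ℕ) : Set T.RootLattice :=
  {m | m ∈ T.posRoots ∧ T.htSigma s m = 0}

/-- The maximal elements of `Δ̂_0⁺` in the root order, in which `a ≤ b` when `b - a` is a (possibly
empty) sum of elements of `Δ̂_0⁺`. -/
def maxRootsZero (T : AffineType) (s : T.Vertex → ℕ) : Set T.RootLattice :=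
  {m | m ∈ T.posRootsZero s ∧ ∀ b ∈ T.posRootsZero s,
    b - m ∈ AddSubmonoid.closure (T.posRootsZero s) → b = m}

open Classical in
/-- The number `ε_i`: it is `1` if `k = 1` or `α_i` is not long, and `2` otherwise. -/
noncomputable def epsilon (T : AffineType) (i : T.Vertex) : ℕ :=
  if T.k = 1 ∨ T.simpleRoot i ∉ T.longRoots then 1 else 2

/-- `Φ_σ = {α_i + ε_i s_i δ} ∪ {kδ - γ | γ maximal in Δ̂_0⁺}`. -/
def PhiSigma (T : AffineType) (s : T.Vertex → ℕ) : Set T.RootLattice :=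
  {m | ∃ i, m = T.simpleRoot i + (T.epsilon i * s i) • T.delta} ∪
    {m | ∃ g ∈ T.maxRootsZero s, m = T.k • T.delta - g}

/-- The cone `C_σ`, the intersection of the half-spaces `Ĥ_α⁺` over the positive roots `α` with
`ht_σ(α) ≠ 1`. -/
noncomputable def coneSigma (T : AffineType) (s : T.Vertex → ℕ) : Set T.HBar :=
  ⋂ a ∈ {a | a ∈ T.posRoots ∧ T.htSigma s a ≠ 1}, T.halfSpace a

end AffineType

/-!
Write `d_i = a_i^∨ / a_i`, let `O` be the set of Weyl group translates of the simple roots, and let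
`f` be an additive functional on the root lattice that is nonnegative on `Φ_σ`. The equality of
cones says that `f ≥ 0` on every positive root of `σ`-height `≠ 1`, for every such `f` of the form
`(·, x)`; the converse inclusion only needs `Φ_σ ⊆ Δ̂⁺` and that `Φ_σ` has no element of height one.

*The roots.* Three facts about `Δ̂` suffice: each root is a nonnegative or a nonpositive combination
of simple roots; `O ⊆ Δ̂`; a positive root outside `O` is killed by all coroots, hence proportional
to `δ`. They follow, as for any Kac–Moody algebra, from the triangular decomposition
(`mem_triangular`), from the stability of `Δ̂` under reflections (`simpleReflection_mem_roots`, by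
`sl₂`-theory, since `ad e_i` and `ad f_i` are locally nilpotent), and by descending the height in a
Weyl orbit (`mem_simpleOrbit_or_coroot_eq_zero`). That the generators of the presented algebra do
not vanish is seen on a highest weight module (`gen_h_ne_zero`). It sits in a coinduced module,
realized on functions on words. A Serre element in the `f_i` commutes with all `e_k`, and so acts by
zero on the coinduced module; one in the `e_i` commutes with all `f_k` and kills the highest weight
vector, and so acts by zero on the highest weight module.

*Translations.* A lattice vector `x` with `(x, x) > 0` and `2 d_j x_j ∈ (x, x) ℤ` for all `j` lies
in `O` (`IsRealType.mem_simpleOrbit`). Indeed its coordinates have one sign, because otherwise its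
positive and its negative part would each have at least the square length of `x`; then reflections
lower its height until it is a simple root. As `2 d_j a_j = 2 a_j^∨`, this criterion shows
`α_i + r δ ∈ O` whenever `a_i^∨ ∣ r a_i`. From the tables `a_i^∨ ∣ k a_i`, so `O` is stable under
translation by `k δ`; and `a_i^∨ = 1` if `k = 2`, `a_i = 1` and `α_i` is not long. Hence
`Φ_σ ⊆ Δ̂⁺`.

*The cone.* One has `ht(k δ) = 2`, and `f δ ≥ 0` because `∑ a_i (α_i + ε_i s_i δ)` is a positive
multiple of `δ`. Let `α` be a positive root in `O` of height `h ≠ 1`, put `r = ⌊h / 2⌋` and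
`β = α - r k δ ∈ O`, of height `0` or `1`. If `β ≥ 0`, then `f β ≥ -k ht(β) f δ` because `ε_i ≤ k`,
and `ht(β) ≤ r`. Otherwise `-β` is a root of height `0`, so `f (-β) ≤ k f δ` by comparison with a
maximal root above it, and `r ≥ 1`. In both cases `f α = f β + r k f δ ≥ 0`.
-/

namespace AffineType

/-! ### Facts read off from the tables -/

theorem label_pos (T : AffineType) (i : T.Vertex) : 0 < T.label i := by
  cases T
  case A l hl => exact Nat.one_pos
  case B l hl => simp only [label]; split_ifs <;> norm_num
  case C l hl => simp only [label]; split_ifs <;> norm_num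
  case D l hl => simp only [label]; split_ifs <;> norm_num
  case twAeven l hl => simp only [label]; split_ifs <;> norm_num
  case twAodd l hl => simp only [label]; split_ifs <;> norm_num
  case twD l hl => exact Nat.one_pos
  all_goals (revert i; decide)

theorem colabel_pos (T : AffineType) (i : T.Vertex) : 0 < T.colabel i := by
  cases T
  case A l hl => exact Nat.one_pos
  case C l hl => exact Nat.one_pos
  case B l hl => simp only [colabel]; split_ifs <;> norm_num
  case D l hl => simp only [colabel]; split_ifs <;> norm_num
  case twAeven l hl => simp only [colabel]; split_ifs <;> norm_num
  case twAodd l hl => simp only [colabel]; split_ifs <;> norm_num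
  case twD l hl => simp only [colabel]; split_ifs <;> norm_num
  all_goals (revert i; decide)

theorem cartan_nonpos (T : AffineType) {i j : T.Vertex} (h : i ≠ j) : T.cartan i j ≤ 0 := by
  cases T
  case A l hl => simp only [cartan]; split_ifs <;> first | contradiction | norm_num
  case B l hl => simp only [cartan]; split_ifs <;> first | contradiction | norm_num
  case C l hl => simp only [cartan]; split_ifs <;> first | contradiction | norm_num
  case D l hl => simp only [cartan]; split_ifs <;> first | contradiction | norm_num
  case twAeven l hl => simp only [cartan]; split_ifs <;> first | contradiction | norm_num
  case twAodd l hl => simp only [cartan]; split_ifs <;> first | contradiction | norm_num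
  case twD l hl => simp only [cartan]; split_ifs <;> first | contradiction | norm_num
  all_goals (fin_cases i <;> fin_cases j <;> first | exact absurd rfl h | decide)

theorem cartan_symm (T : AffineType) (i j : T.Vertex) :
    (T.colabel i : ℤ) * T.label j * T.cartan i j = T.colabel j * T.label i * T.cartan j i := by
  cases T
  case A l hl =>
    simp only [cartan, label, colabel]
    grind (splits := 40)
  case B l hl =>
    have hi := i.2
    have hj := j.2
    simp only [cartan, label, colabel, rank] at *
    grind (splits := 40)
  case C l hl =>
    have hi := i.2
    have hj := j.2
    simp only [cartan, label, colabel, rank] at *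
    grind (splits := 40)
  case D l hl =>
    have hi := i.2
    have hj := j.2
    simp only [cartan, label, colabel, rank] at *
    grind (splits := 40)
  case twAeven l hl =>
    have hi := i.2
    have hj := j.2
    simp only [cartan, label, colabel, rank] at *
    grind (splits := 40)
  case twAodd l hl =>
    have hi := i.2
    have hj := j.2
    simp only [cartan, label, colabel, rank] at *
    grind (splits := 40)
  case twD l hl =>
    have hi := i.2
    have hj := j.2
    simp only [cartan, label, colabel, rank] at *
    grind (splits := 40)
  all_goals (revert i j; decide)

theorem colabel_dvd (T : AffineType) (i : T.Vertex) : T.colabel i ∣ T.k * T.label i := by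
  cases T
  case A l hl => exact one_dvd _
  case C l hl => exact one_dvd _
  case B l hl => simp only [label, colabel, k]; split_ifs <;> omega
  case D l hl => simp only [label, colabel, k]; split_ifs <;> norm_num
  case twAeven l hl => simp only [label, colabel, k]; split_ifs <;> norm_num
  case twAodd l hl => simp only [label, colabel, k]; split_ifs <;> omega
  case twD l hl => simp only [label, colabel, k]; split_ifs <;> norm_num
  all_goals (revert i; decide)

/-- Connectedness of the affine diagram: the vertices can be ranked so that every vertex except
one has a neighbour of smaller rank. -/
theorem exists_rank_connected (T : AffineType) : ∃ (r : T.Vertex) (ρ : T.Vertex → ℕ),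
    ∀ i, i ≠ r → ∃ j, ρ j < ρ i ∧ T.cartan i j ≠ 0 := by
  cases T
  case A l hl =>
    refine ⟨(0 : Fin (l + 1)), fun i => i.val, fun i hi => ?_⟩
    change Fin (l + 1) at i
    have hi' : i.val ≠ 0 := fun h => hi (Fin.ext h)
    refine ⟨(⟨i - 1, by omega⟩ : Fin (l + 1)), by simp only; omega, ?_⟩
    simp only [cartan, Fin.ext_iff]
    grind
  case B l hl =>
    refine ⟨(⟨2, by omega⟩ : Fin (l + 1)), fun i => if i.val ≤ 1 then 3 else i.val, fun i hi => ?_⟩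
    change Fin (l + 1) at i
    have hi' : i.val ≠ 2 := fun h => hi (Fin.ext h)
    have := i.2
    refine ⟨(⟨if i.val ≤ 1 then 2 else i - 1, by split_ifs <;> omega⟩ : Fin (l + 1)), ?_, ?_⟩
    · grind
    · simp only [cartan, Fin.ext_iff]
      grind
  case C l hl =>
    refine ⟨(0 : Fin (l + 1)), fun i => i.val, fun i hi => ?_⟩
    change Fin (l + 1) at i
    have hi' : i.val ≠ 0 := fun h => hi (Fin.ext h)
    refine ⟨(⟨i - 1, by omega⟩ : Fin (l + 1)), by simp only; omega, ?_⟩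
    simp only [cartan, Fin.ext_iff]
    grind
  case D l hl =>
    refine ⟨(⟨2, by omega⟩ : Fin (l + 1)), fun i => if i.val ≤ 1 then 3 else i.val, fun i hi => ?_⟩
    change Fin (l + 1) at i
    have hi' : i.val ≠ 2 := fun h => hi (Fin.ext h)
    have := i.2
    refine ⟨(⟨if i.val ≤ 1 then 2 else if i.val = l then l - 2 else i - 1, by
      split_ifs <;> omega⟩ : Fin (l + 1)), ?_, ?_⟩
    · grind
    · simp only [cartan, Fin.ext_iff]
      grind
  case twAeven l hl =>
    refine ⟨(0 : Fin (l + 1)), fun i => i.val, fun i hi => ?_⟩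
    change Fin (l + 1) at i
    have hi' : i.val ≠ 0 := fun h => hi (Fin.ext h)
    refine ⟨(⟨i - 1, by omega⟩ : Fin (l + 1)), by simp only; omega, ?_⟩
    simp only [cartan, Fin.ext_iff]
    grind
  case twAodd l hl =>
    refine ⟨(⟨2, by omega⟩ : Fin (l + 1)), fun i => if i.val ≤ 1 then 3 else i.val, fun i hi => ?_⟩
    change Fin (l + 1) at i
    have hi' : i.val ≠ 2 := fun h => hi (Fin.ext h)
    have := i.2
    refine ⟨(⟨if i.val ≤ 1 then 2 else i - 1, by split_ifs <;> omega⟩ : Fin (l + 1)), ?_, ?_⟩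
    · grind
    · simp only [cartan, Fin.ext_iff]
      grind
  case twD l hl =>
    refine ⟨(0 : Fin (l + 1)), fun i => i.val, fun i hi => ?_⟩
    change Fin (l + 1) at i
    have hi' : i.val ≠ 0 := fun h => hi (Fin.ext h)
    refine ⟨(⟨i - 1, by omega⟩ : Fin (l + 1)), by simp only; omega, ?_⟩
    simp only [cartan, Fin.ext_iff]
    grind
  case E6 =>
    refine ⟨(3 : Fin 7), (![2, 2, 1, 0, 1, 2, 1] : Fin 7 → ℕ), fun i hi =>
      ⟨(![6, 2, 3, 3, 3, 4, 3] : Fin 7 → Fin 7) i, ?_⟩⟩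
    fin_cases i <;> first | exact absurd rfl hi | decide
  case A1 =>
    refine ⟨(0 : Fin 2), fun i => i.val, fun i hi =>
      ⟨(![0, 0] : Fin 2 → Fin 2) i, ?_⟩⟩
    fin_cases i <;> first | exact absurd rfl hi | decide
  case twA2 =>
    refine ⟨(0 : Fin 2), fun i => i.val, fun i hi =>
      ⟨(![0, 0] : Fin 2 → Fin 2) i, ?_⟩⟩
    fin_cases i <;> first | exact absurd rfl hi | decide
  case E7 =>
    refine ⟨(0 : Fin 8), fun i => i.val, fun i hi =>
      ⟨(![0, 0, 1, 2, 3, 4, 5, 3] : Fin 8 → Fin 8) i, ?_⟩⟩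
    fin_cases i <;> first | exact absurd rfl hi | decide
  case E8 =>
    refine ⟨(0 : Fin 9), fun i => i.val, fun i hi =>
      ⟨(![0, 0, 1, 2, 3, 4, 5, 6, 5] : Fin 9 → Fin 9) i, ?_⟩⟩
    fin_cases i <;> first | exact absurd rfl hi | decide
  case F4 =>
    refine ⟨(0 : Fin 5), fun i => i.val, fun i hi =>
      ⟨(![0, 0, 1, 2, 3] : Fin 5 → Fin 5) i, ?_⟩⟩
    fin_cases i <;> first | exact absurd rfl hi | decide
  case twE6 =>
    refine ⟨(0 : Fin 5), fun i => i.val, fun i hi =>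
      ⟨(![0, 0, 1, 2, 3] : Fin 5 → Fin 5) i, ?_⟩⟩
    fin_cases i <;> first | exact absurd rfl hi | decide
  case G2 =>
    refine ⟨(0 : Fin 3), fun i => i.val, fun i hi =>
      ⟨(![0, 0, 1] : Fin 3 → Fin 3) i, ?_⟩⟩
    fin_cases i <;> first | exact absurd rfl hi | decide
  case twD4 =>
    refine ⟨(0 : Fin 3), fun i => i.val, fun i hi =>
      ⟨(![0, 0, 1] : Fin 3 → Fin 3) i, ?_⟩⟩
    fin_cases i <;> first | exact absurd rfl hi | decide

/-- A function on the vertices that agrees on neighbours is constant. -/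
theorem eq_of_forall_neighbour_eq {T : AffineType} {X : Type*} (x : T.Vertex → X)
    (h : ∀ i j, T.cartan i j ≠ 0 → x i = x j) (i j : T.Vertex) : x i = x j := by
  obtain ⟨r, ρ, hρ⟩ := T.exists_rank_connected
  suffices H : ∀ n i, ρ i = n → x i = x r from (H _ i rfl).trans (H _ j rfl).symm
  intro n
  induction n using Nat.strong_induction_on with
  | _ n ih =>
    rintro i rfl
    by_cases hi : i = r
    · rw [hi]
    · obtain ⟨j, hj, hc⟩ := hρ i hi
      exact (h i j hc).trans (ih _ hj j rfl)

/-! ### The standard form on the root lattice -/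

/-- The standard form restricted to the root lattice. -/
noncomputable def latticeForm (T : AffineType) (x y : T.RootLattice) : ℝ :=
  T.form (T.toHDual x) (T.toHDual y)

/-- Half the square length of `α_i`, that is `a_i^∨ / a_i`. -/
noncomputable def halfNorm (T : AffineType) (i : T.Vertex) : ℝ :=
  (T.colabel i : ℝ) / (T.label i : ℝ)

theorem halfNorm_pos (T : AffineType) (i : T.Vertex) : 0 < T.halfNorm i :=
  div_pos (Nat.cast_pos.2 (T.colabel_pos i)) (Nat.cast_pos.2 (T.label_pos i))

theorem label_mul_halfNorm (T : AffineType) (i : T.Vertex) :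
    (T.label i : ℝ) * T.halfNorm i = T.colabel i :=
  mul_div_cancel₀ _ (Nat.cast_ne_zero.2 (T.label_pos i).ne')

theorem halfNorm_mul_cartan (T : AffineType) (i j : T.Vertex) :
    T.halfNorm i * T.cartan i j = T.halfNorm j * T.cartan j i := by
  have h : (T.colabel i : ℝ) * T.label j * T.cartan i j
      = T.colabel j * T.label i * T.cartan j i := by exact_mod_cast T.cartan_symm i j
  have hi : (T.label i : ℝ) ≠ 0 := Nat.cast_ne_zero.2 (T.label_pos i).ne'
  have hj : (T.label j : ℝ) ≠ 0 := Nat.cast_ne_zero.2 (T.label_pos j).ne'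
  unfold halfNorm
  field_simp
  linarith

theorem toHDual_add (T : AffineType) (x y : T.RootLattice) :
    T.toHDual (x + y) = T.toHDual x + T.toHDual y := by
  ext <;> simp [toHDual]

theorem latticeForm_eq (T : AffineType) (x y : T.RootLattice) :
    T.latticeForm x y = ∑ i, ∑ j, (x i : ℝ) * (T.halfNorm i * T.cartan i j) * y j := by
  simp [latticeForm, form, toHDual, halfNorm, mul_assoc]

theorem latticeForm_comm (T : AffineType) (x y : T.RootLattice) :
    T.latticeForm x y = T.latticeForm y x := by
  rw [latticeForm_eq, latticeForm_eq, Finset.sum_comm]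
  refine Finset.sum_congr rfl fun i _ => Finset.sum_congr rfl fun j _ => ?_
  rw [T.halfNorm_mul_cartan]
  ring

theorem latticeForm_add_left (T : AffineType) (x y z : T.RootLattice) :
    T.latticeForm (x + y) z = T.latticeForm x z + T.latticeForm y z := by
  simp [latticeForm, toHDual_add]

theorem latticeForm_add_right (T : AffineType) (x y z : T.RootLattice) :
    T.latticeForm x (y + z) = T.latticeForm x y + T.latticeForm x z := by
  simp [latticeForm, toHDual_add]

theorem toHDual_zsmul (T : AffineType) (n : ℤ) (x : T.RootLattice) :
    T.toHDual (n • x) = (n : ℝ) • T.toHDual x := by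
  ext <;> simp [toHDual]

theorem latticeForm_zsmul_left (T : AffineType) (n : ℤ) (x y : T.RootLattice) :
    T.latticeForm (n • x) y = n * T.latticeForm x y := by
  rw [latticeForm, toHDual_zsmul, map_smul]
  rfl

theorem latticeForm_zsmul_right (T : AffineType) (n : ℤ) (x y : T.RootLattice) :
    T.latticeForm x (n • y) = n * T.latticeForm x y := by
  rw [latticeForm, toHDual_zsmul, map_smul]
  rfl

theorem coroot_apply (T : AffineType) (i : T.Vertex) (m : T.RootLattice) :
    T.coroot i m = ∑ j, T.cartan i j * m j := by
  simp [coroot]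

theorem coroot_simpleRoot (T : AffineType) (i j : T.Vertex) :
    T.coroot i (T.simpleRoot j) = T.cartan i j := by
  simp [coroot_apply, simpleRoot, Pi.single_apply]

theorem coroot_delta (T : AffineType) (i : T.Vertex) : T.coroot i T.delta = 0 := by
  rw [coroot_apply]
  exact T.sum_cartan_mul_label i

theorem latticeForm_eq_sum_coroot (T : AffineType) (x y : T.RootLattice) :
    T.latticeForm x y = ∑ i, (x i : ℝ) * T.halfNorm i * T.coroot i y := by
  rw [latticeForm_eq]
  refine Finset.sum_congr rfl fun i _ => ?_
  rw [coroot_apply, Int.cast_sum, Finset.mul_sum]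
  refine Finset.sum_congr rfl fun j _ => ?_
  push_cast
  ring

theorem latticeForm_simpleRoot_left (T : AffineType) (i : T.Vertex) (y : T.RootLattice) :
    T.latticeForm (T.simpleRoot i) y = T.halfNorm i * T.coroot i y := by
  rw [latticeForm_eq_sum_coroot, Finset.sum_eq_single i]
  · simp [simpleRoot]
  · intro j _ hj
    simp [simpleRoot, hj]
  · simp

theorem latticeForm_simpleRoot_self (T : AffineType) (i : T.Vertex) :
    T.latticeForm (T.simpleRoot i) (T.simpleRoot i) = 2 * T.halfNorm i := by
  rw [latticeForm_simpleRoot_left, coroot_simpleRoot_self]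
  push_cast
  ring

theorem latticeForm_delta_right (T : AffineType) (x : T.RootLattice) :
    T.latticeForm x T.delta = 0 := by
  simp [latticeForm_eq_sum_coroot, coroot_delta]

theorem latticeForm_delta_left (T : AffineType) (x : T.RootLattice) :
    T.latticeForm T.delta x = 0 := by
  rw [latticeForm_comm, latticeForm_delta_right]

theorem latticeForm_zero (T : AffineType) : T.latticeForm 0 0 = 0 := by
  simp [latticeForm_eq]

theorem simpleReflection_apply (T : AffineType) (i : T.Vertex) (m : T.RootLattice) :
    T.simpleReflection i m = m - T.coroot i m • T.simpleRoot i := by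
  simp [simpleReflection, Module.reflection_apply]

theorem simpleReflection_delta (T : AffineType) (i : T.Vertex) :
    T.simpleReflection i T.delta = T.delta := by
  simp [simpleReflection_apply, coroot_delta]

theorem simpleReflection_simpleRoot_self (T : AffineType) (i : T.Vertex) :
    T.simpleReflection i (T.simpleRoot i) = -T.simpleRoot i := by
  rw [simpleReflection_apply, coroot_simpleRoot_self]
  module

theorem simpleReflection_involutive (T : AffineType) (i : T.Vertex) :
    Function.Involutive (T.simpleReflection i) :=
  Module.involutive_reflection (T.coroot_simpleRoot_self i)

theorem latticeForm_simpleReflection (T : AffineType) (i : T.Vertex) (x : T.RootLattice) :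
    T.latticeForm (T.simpleReflection i x) (T.simpleReflection i x) = T.latticeForm x x := by
  rw [simpleReflection_apply, sub_eq_add_neg, ← neg_smul]
  simp only [latticeForm_add_left, latticeForm_add_right, latticeForm_zsmul_left,
    latticeForm_zsmul_right, latticeForm_simpleRoot_self]
  rw [T.latticeForm_comm x (T.simpleRoot i), latticeForm_simpleRoot_left]
  push_cast
  ring

/-- The form as a weighted sum of squares: with `∑ a_i α_i` in the kernel, the quadratic form is
`-½ ∑ (α_i, α_j) a_i a_j (x_i / a_i - x_j / a_j)²`. -/
theorem latticeForm_self_eq (T : AffineType) (x : T.RootLattice) :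
    T.latticeForm x x = ∑ i, ∑ j, -(1 / 2) * (T.halfNorm i * T.cartan i j) *
      (T.label i * T.label j) * ((x i : ℝ) / T.label i - x j / T.label j) ^ 2 := by
  have hl : ∀ i, (T.label i : ℝ) ≠ 0 := fun i => Nat.cast_ne_zero.2 (T.label_pos i).ne'
  have hker : ∀ i, ∑ j, (T.cartan i j : ℝ) * T.label j = 0 := fun i => by
    exact_mod_cast T.sum_cartan_mul_label i
  have h1 : ∑ i, ∑ j, (T.halfNorm i * T.cartan i j) * T.label j * ((x i : ℝ) ^ 2 / T.label i)
      = 0 := by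
    refine Finset.sum_eq_zero fun i _ => ?_
    have : ∀ j, (T.halfNorm i * T.cartan i j) * T.label j * ((x i : ℝ) ^ 2 / T.label i)
        = (T.halfNorm i * ((x i : ℝ) ^ 2 / T.label i)) * (T.cartan i j * T.label j) :=
      fun j => by ring
    simp only [this, ← Finset.mul_sum, hker, mul_zero]
  have h2 : ∑ i, ∑ j, (T.halfNorm i * T.cartan i j) * T.label i * ((x j : ℝ) ^ 2 / T.label j)
      = 0 := by
    rw [Finset.sum_comm, ← h1]
    refine Finset.sum_congr rfl fun i _ => Finset.sum_congr rfl fun j _ => ?_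
    rw [T.halfNorm_mul_cartan]
  have h3 : ∀ i j, -(1 / 2) * (T.halfNorm i * T.cartan i j) *
      (T.label i * T.label j) * ((x i : ℝ) / T.label i - x j / T.label j) ^ 2
      = (x i : ℝ) * (T.halfNorm i * T.cartan i j) * x j
        - 1 / 2 * ((T.halfNorm i * T.cartan i j) * T.label j * ((x i : ℝ) ^ 2 / T.label i))
        - 1 / 2 * ((T.halfNorm i * T.cartan i j) * T.label i * ((x j : ℝ) ^ 2 / T.label j)) := by
    intro i j
    have := hl i
    have := hl j
    field_simp
    ring
  simp only [h3, Finset.sum_sub_distrib, ← Finset.mul_sum, h1, h2]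
  rw [latticeForm_eq]
  ring

theorem weighted_square_nonneg (T : AffineType) (x : T.RootLattice) (i j : T.Vertex) :
    0 ≤ -(1 / 2) * (T.halfNorm i * T.cartan i j) *
      (T.label i * T.label j) * ((x i : ℝ) / T.label i - x j / T.label j) ^ 2 := by
  by_cases h : i = j
  · simp [h]
  · have hc : (T.cartan i j : ℝ) ≤ 0 := by exact_mod_cast T.cartan_nonpos h
    have := mul_nonpos_of_nonneg_of_nonpos (T.halfNorm_pos i).le hc
    have : 0 ≤ -(1 / 2) * (T.halfNorm i * T.cartan i j) := by linarith
    positivity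

theorem latticeForm_self_nonneg (T : AffineType) (x : T.RootLattice) :
    0 ≤ T.latticeForm x x := by
  rw [latticeForm_self_eq]
  exact Finset.sum_nonneg fun i _ => Finset.sum_nonneg fun j _ => T.weighted_square_nonneg x i j

/-- The isotropic vectors are proportional to `δ`. -/
theorem ratio_eq_of_latticeForm_self_eq_zero (T : AffineType) {x : T.RootLattice}
    (hx : T.latticeForm x x = 0) (i j : T.Vertex) :
    (x i : ℝ) / T.label i = x j / T.label j := by
  refine eq_of_forall_neighbour_eq (fun i => (x i : ℝ) / T.label i) (fun i j hc => ?_) i j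
  rw [latticeForm_self_eq, Finset.sum_eq_zero_iff_of_nonneg fun i _ =>
    Finset.sum_nonneg fun j _ => T.weighted_square_nonneg x i j] at hx
  have := (Finset.sum_eq_zero_iff_of_nonneg fun j _ => T.weighted_square_nonneg x i j).1
    (hx i (Finset.mem_univ i)) j (Finset.mem_univ j)
  have hc' : (T.cartan i j : ℝ) ≠ 0 := Int.cast_ne_zero.2 hc
  have hl : ∀ i, (T.label i : ℝ) ≠ 0 := fun i => Nat.cast_ne_zero.2 (T.label_pos i).ne'
  have h0 := (T.halfNorm_pos i).ne'
  simp only [mul_eq_zero, hc', hl, h0, or_false, false_or, neg_eq_zero, one_div, inv_eq_zero,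
    OfNat.ofNat_ne_zero, pow_eq_zero_iff, ne_eq, not_false_eq_true] at this
  exact sub_eq_zero.1 this

theorem eq_zero_of_latticeForm_self_eq_zero (T : AffineType) {x : T.RootLattice}
    (hx : T.latticeForm x x = 0) {i : T.Vertex} (hi : x i = 0) : x = 0 := by
  funext j
  have := T.ratio_eq_of_latticeForm_self_eq_zero hx j i
  rw [hi, Int.cast_zero, zero_div, div_eq_zero_iff] at this
  exact Int.cast_eq_zero.1 (this.resolve_right (Nat.cast_ne_zero.2 (T.label_pos j).ne'))

/-- A weight on which all coroots are nonpositive is annihilated by all of them. -/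
theorem coroot_eq_zero_of_nonpos (T : AffineType) {x : T.RootLattice}
    (hx : ∀ i, T.coroot i x ≤ 0) (i : T.Vertex) : T.coroot i x = 0 := by
  have h := T.latticeForm_delta_left x
  rw [latticeForm_eq_sum_coroot, Finset.sum_eq_zero_iff_of_nonpos] at h
  · have := h i (Finset.mem_univ i)
    simpa [delta, (T.halfNorm_pos i).ne', (T.label_pos i).ne'] using this
  · intro j _
    have h1 : (0 : ℝ) ≤ (T.delta j : ℝ) * T.halfNorm j :=
      mul_nonneg (by simp [delta]) (T.halfNorm_pos j).le
    exact mul_nonpos_of_nonneg_of_nonpos h1 (by exact_mod_cast hx j)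

theorem eq_zero_of_coroot_eq_zero (T : AffineType) {x : T.RootLattice}
    (hx : ∀ i, T.coroot i x = 0) (h0 : x 0 = 0) : x = 0 :=
  T.eq_zero_of_latticeForm_self_eq_zero (i := 0) (by simp [latticeForm_eq_sum_coroot, hx]) h0

/-! ### The Weyl orbits of the simple roots -/

/-- The vectors that are Weyl group conjugate to a simple root. These are the real roots, but
being a root is not part of the definition. -/
def simpleOrbit (T : AffineType) : Set T.RootLattice :=
  {m | ∃ w ∈ T.weylGroup, ∃ i, m = w (T.simpleRoot i)}

theorem simpleRoot_mem_simpleOrbit (T : AffineType) (i : T.Vertex) :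
    T.simpleRoot i ∈ T.simpleOrbit :=
  ⟨1, one_mem _, i, rfl⟩

theorem simpleReflection_mem_weylGroup (T : AffineType) (i : T.Vertex) :
    T.simpleReflection i ∈ T.weylGroup :=
  Subgroup.subset_closure ⟨i, rfl⟩

theorem map_mem_simpleOrbit (T : AffineType) {w : T.RootLattice ≃ₗ[ℤ] T.RootLattice}
    (hw : w ∈ T.weylGroup) {m : T.RootLattice} (hm : m ∈ T.simpleOrbit) :
    w m ∈ T.simpleOrbit := by
  obtain ⟨v, hv, i, rfl⟩ := hm
  exact ⟨w * v, mul_mem hw hv, i, rfl⟩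

theorem neg_mem_simpleOrbit (T : AffineType) {m : T.RootLattice} (hm : m ∈ T.simpleOrbit) :
    -m ∈ T.simpleOrbit := by
  obtain ⟨w, hw, i, rfl⟩ := hm
  exact ⟨w * T.simpleReflection i, mul_mem hw (T.simpleReflection_mem_weylGroup i), i,
    by rw [LinearEquiv.mul_apply, simpleReflection_simpleRoot_self, map_neg]⟩

/-- Induction over the Weyl group: a property stable under simple reflections is stable under the
whole group. -/
theorem weylGroup_induction (T : AffineType) {P : T.RootLattice → Prop}
    (h : ∀ i m, P m → P (T.simpleReflection i m)) {w : T.RootLattice ≃ₗ[ℤ] T.RootLattice}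
    (hw : w ∈ T.weylGroup) : ∀ m, P m → P (w m) := by
  induction hw using Subgroup.closure_induction'' with
  | mem x hx =>
    obtain ⟨i, rfl⟩ := hx
    exact h i
  | inv_mem x hx =>
    obtain ⟨i, rfl⟩ := hx
    intro m hm
    have : (T.simpleReflection i)⁻¹ = T.simpleReflection i := by
      rw [inv_eq_iff_mul_eq_one]
      ext1 y
      exact T.simpleReflection_involutive i y
    rw [this]
    exact h i m hm
  | one => exact fun m hm => hm
  | mul x y _ _ hx hy => exact fun m hm => hx _ (hy m hm)

theorem weylGroup_delta (T : AffineType) {w : T.RootLattice ≃ₗ[ℤ] T.RootLattice}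
    (hw : w ∈ T.weylGroup) : w T.delta = T.delta :=
  T.weylGroup_induction (P := fun m => m = T.delta)
    (fun i m hm => by rw [hm, simpleReflection_delta]) hw _ rfl

theorem latticeForm_weylGroup (T : AffineType) {w : T.RootLattice ≃ₗ[ℤ] T.RootLattice}
    (hw : w ∈ T.weylGroup) (m : T.RootLattice) :
    T.latticeForm (w m) (w m) = T.latticeForm m m :=
  T.weylGroup_induction (P := fun x => T.latticeForm x x = T.latticeForm m m)
    (fun i x hx => by rw [latticeForm_simpleReflection, hx]) hw m rfl

/-- Vectors `x` of positive square length such that `2 x / (x, x)` lies in the coroot lattice. -/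
def IsRealType (T : AffineType) (x : T.RootLattice) : Prop :=
  0 < T.latticeForm x x ∧
    ∀ j, (x j : ℝ) * (2 * T.halfNorm j) ∈ AddSubgroup.zmultiples (T.latticeForm x x)

theorem IsRealType.simpleReflection {T : AffineType} {x : T.RootLattice} (hx : T.IsRealType x)
    (i : T.Vertex) : T.IsRealType (T.simpleReflection i x) := by
  refine ⟨by rw [latticeForm_simpleReflection]; exact hx.1, fun j => ?_⟩
  rw [latticeForm_simpleReflection, simpleReflection_apply]
  by_cases hj : j = i
  · subst hj
    have : (((x - T.coroot j x • T.simpleRoot j) j : ℤ) : ℝ) * (2 * T.halfNorm j)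
        = (x j : ℝ) * (2 * T.halfNorm j)
          - ∑ k, T.cartan k j • ((x k : ℝ) * (2 * T.halfNorm k)) := by
      have hc : (x - T.coroot j x • T.simpleRoot j) j = x j - T.coroot j x := by
        simp [simpleRoot]
      rw [hc]
      simp only [Int.cast_sub, sub_mul, coroot_apply, Int.cast_sum, Finset.sum_mul, zsmul_eq_mul]
      congr 1
      refine Finset.sum_congr rfl fun k _ => ?_
      have := T.halfNorm_mul_cartan j k
      push_cast
      linear_combination 2 * (x k : ℝ) * this
    rw [this]
    exact sub_mem (hx.2 j) (sum_mem fun k _ => zsmul_mem (hx.2 k) _)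
  · simpa [simpleRoot, hj] using hx.2 j

theorem IsRealType.neg {T : AffineType} {x : T.RootLattice} (hx : T.IsRealType x) :
    T.IsRealType (-x) := by
  have h : T.latticeForm (-x) (-x) = T.latticeForm x x := by simp [latticeForm_eq]
  refine ⟨by rw [h]; exact hx.1, fun j => ?_⟩
  rw [h]
  simpa using neg_mem (hx.2 j)

/-- The part of `x` supported on `S`. -/
def restrictTo (T : AffineType) (S : Finset T.Vertex) (x : T.RootLattice) : T.RootLattice :=
  fun i => if i ∈ S then x i else 0

theorem IsRealType.latticeForm_restrictTo_mem {T : AffineType} {x : T.RootLattice}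
    (hx : T.IsRealType x) (S : Finset T.Vertex) :
    T.latticeForm (T.restrictTo S x) (T.restrictTo S x)
      ∈ AddSubgroup.zmultiples (T.latticeForm x x) := by
  induction S using Finset.induction_on with
  | empty =>
    have : T.restrictTo ∅ x = 0 := by funext i; simp [restrictTo]
    rw [this, latticeForm_zero]
    exact zero_mem _
  | insert i S hi ih =>
    have : T.restrictTo (insert i S) x = x i • T.simpleRoot i + T.restrictTo S x := by
      funext j
      by_cases hj : j = i
      · subst hj; simp [restrictTo, simpleRoot, hi]
      · simp [restrictTo, simpleRoot, hj]
    rw [this]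
    simp only [latticeForm_add_left, latticeForm_add_right, latticeForm_zsmul_left,
      latticeForm_zsmul_right, latticeForm_simpleRoot_self]
    rw [T.latticeForm_comm (T.restrictTo S x) (T.simpleRoot i), latticeForm_simpleRoot_left]
    have h := hx.2 i
    have e : (x i : ℝ) * ((x i : ℝ) * (2 * T.halfNorm i)
        + T.halfNorm i * T.coroot i (T.restrictTo S x))
        + (x i * (T.halfNorm i * T.coroot i (T.restrictTo S x))
          + T.latticeForm (T.restrictTo S x) (T.restrictTo S x))
        = (x i + T.coroot i (T.restrictTo S x)) • ((x i : ℝ) * (2 * T.halfNorm i))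
          + T.latticeForm (T.restrictTo S x) (T.restrictTo S x) := by
      rw [zsmul_eq_mul]
      push_cast
      ring
    rw [e]
    exact add_mem (zsmul_mem h _) ih

theorem le_of_pos_of_mem_zmultiples {q y : ℝ} (hq : 0 < q) (hy : 0 < y)
    (h : y ∈ AddSubgroup.zmultiples q) : q ≤ y := by
  obtain ⟨n, rfl⟩ := AddSubgroup.mem_zmultiples_iff.1 h
  rw [zsmul_eq_mul] at hy ⊢
  have : 0 < n := by
    by_contra! hn
    have : (n : ℝ) ≤ 0 := by exact_mod_cast hn
    nlinarith
  have : (1 : ℝ) ≤ n := by exact_mod_cast this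
  nlinarith

/-- The coordinates of a vector of real type all have the same sign: otherwise its positive and
its negative part would each have at least the square length of the whole vector. -/
theorem IsRealType.nonneg_or_nonpos {T : AffineType} {x : T.RootLattice} (hx : T.IsRealType x) :
    (∀ i, 0 ≤ x i) ∨ (∀ i, x i ≤ 0) := by
  by_contra! hcon
  obtain ⟨⟨i, hi⟩, ⟨j, hj⟩⟩ := hcon
  set S : Finset T.Vertex := Finset.univ.filter fun i => 0 < x i with hS
  have hsum : x = T.restrictTo S x + T.restrictTo Sᶜ x := by
    funext l
    by_cases hl : l ∈ S <;> simp [restrictTo, hl]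
  have hpos : ∀ (U : Finset T.Vertex) (a b : T.Vertex), a ∈ U → x a ≠ 0 → b ∉ U →
      T.latticeForm x x ≤ T.latticeForm (T.restrictTo U x) (T.restrictTo U x) := by
    intro U a b ha hxa hb
    refine le_of_pos_of_mem_zmultiples hx.1 (lt_of_le_of_ne (T.latticeForm_self_nonneg _) ?_)
      (hx.latticeForm_restrictTo_mem U)
    intro h0
    have := congrFun (T.eq_zero_of_latticeForm_self_eq_zero h0.symm (i := b)
      (by simp [restrictTo, hb])) a
    simp [restrictTo, ha] at this
    exact hxa this
  have hiS : i ∉ S := by simp [hS, hi.le]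
  have hjS : j ∈ S := by simp [hS, hj]
  have h1 := hpos S j i hjS hj.ne' hiS
  have h2 := hpos Sᶜ i j (by simpa using hiS) hi.ne (by simpa using hjS)
  have h3 : 0 ≤ T.latticeForm (T.restrictTo S x) (T.restrictTo Sᶜ x) := by
    rw [latticeForm_eq]
    refine Finset.sum_nonneg fun a _ => Finset.sum_nonneg fun b _ => ?_
    by_cases ha : a ∈ S
    · by_cases hb : b ∈ S
      · simp [restrictTo, hb]
      · have hab : a ≠ b := fun h => hb (h ▸ ha)
        have hxa : (0 : ℝ) ≤ x a := by
          have : 0 < x a := by simpa [hS] using ha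
          exact_mod_cast this.le
        have hxb : (x b : ℝ) ≤ 0 := by
          have : x b ≤ 0 := by simpa [hS] using hb
          exact_mod_cast this
        have hc : (T.cartan a b : ℝ) ≤ 0 := by exact_mod_cast T.cartan_nonpos hab
        have hd := mul_nonpos_of_nonneg_of_nonpos (T.halfNorm_pos a).le hc
        simp only [restrictTo, ha, hb, if_true, Finset.mem_compl, not_false_eq_true]
        exact mul_nonneg_of_nonpos_of_nonpos (mul_nonpos_of_nonneg_of_nonpos hxa hd) hxb
    · simp [restrictTo, ha]
  have h4 : T.latticeForm x x = T.latticeForm (T.restrictTo S x) (T.restrictTo S x)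
      + 2 * T.latticeForm (T.restrictTo S x) (T.restrictTo Sᶜ x)
      + T.latticeForm (T.restrictTo Sᶜ x) (T.restrictTo Sᶜ x) := by
    conv_lhs => rw [hsum]
    simp only [latticeForm_add_left, latticeForm_add_right]
    rw [T.latticeForm_comm (T.restrictTo Sᶜ x) (T.restrictTo S x)]
    ring
  linarith [hx.1]

/-- A vector `n α_i` of real type is `α_i` if `n ≥ 0`. -/
theorem IsRealType.eq_one_of_eq_smul {T : AffineType} {x : T.RootLattice} (hx : T.IsRealType x)
    {i : T.Vertex} (h : x = x i • T.simpleRoot i) (hi : 0 ≤ x i) : x i = 1 := by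
  obtain ⟨z, hz⟩ := AddSubgroup.mem_zmultiples_iff.1 (hx.2 i)
  have hq : T.latticeForm x x = x i * (x i * (2 * T.halfNorm i)) := by
    conv_lhs => rw [h]
    rw [latticeForm_zsmul_left, latticeForm_zsmul_right, latticeForm_simpleRoot_self]
  have hpos := hx.1
  rw [hq] at hpos hz
  have hne : (x i : ℝ) * (2 * T.halfNorm i) ≠ 0 := by
    intro h0
    simp [h0] at hpos
  have : ((z * x i : ℤ) : ℝ) * ((x i : ℝ) * (2 * T.halfNorm i))
      = ((1 : ℤ) : ℝ) * ((x i : ℝ) * (2 * T.halfNorm i)) := by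
    rw [zsmul_eq_mul] at hz
    push_cast
    linarith
  have h1 : z * x i = 1 := by exact_mod_cast mul_right_cancel₀ hne this
  exact Int.eq_one_of_dvd_one hi ⟨z, by rw [mul_comm, h1]⟩

theorem IsRealType.mem_simpleOrbit_of_nonneg {T : AffineType} (n : ℕ) :
    ∀ x : T.RootLattice, T.IsRealType x → (∀ i, 0 ≤ x i) → ∑ i, x i ≤ n → x ∈ T.simpleOrbit := by
  induction n with
  | zero =>
    intro x hx hpos hsum
    have hz := (Finset.sum_eq_zero_iff_of_nonneg fun i _ => hpos i).1
      (le_antisymm hsum (Finset.sum_nonneg fun i _ => hpos i))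
    have : x = 0 := funext fun i => hz i (Finset.mem_univ i)
    exact absurd hx.1 (by rw [this, latticeForm_zero]; exact lt_irrefl _)
  | succ n ih =>
    intro x hx hpos hsum
    obtain ⟨i, hi⟩ : ∃ i, 0 < T.coroot i x := by
      by_contra! hcon
      have : T.latticeForm x x = 0 := by
        simp [latticeForm_eq_sum_coroot, T.coroot_eq_zero_of_nonpos hcon]
      exact hx.1.ne' this
    have hy := hx.simpleReflection i
    have hyx : ∀ j, j ≠ i → T.simpleReflection i x j = x j := fun j hj => by
      simp [simpleReflection_apply, simpleRoot, hj]
    rcases hy.nonneg_or_nonpos with h | h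
    · have hsum' : ∑ j, T.simpleReflection i x j ≤ n := by
        have : ∑ j, T.simpleReflection i x j = ∑ j, x j - T.coroot i x := by
          simp [simpleReflection_apply, Finset.sum_sub_distrib, ← Finset.mul_sum, simpleRoot]
        push_cast at hsum
        omega
      have := T.map_mem_simpleOrbit (T.simpleReflection_mem_weylGroup i) (ih _ hy h hsum')
      rwa [T.simpleReflection_involutive i x] at this
    · have hx' : x = x i • T.simpleRoot i := by
        funext j
        by_cases hj : j = i
        · subst hj; simp [simpleRoot]
        · have := h j
          rw [hyx j hj] at this
          simp [simpleRoot, hj, le_antisymm this (hpos j)]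
      rw [hx', hx.eq_one_of_eq_smul hx' (hpos i), one_smul]
      exact T.simpleRoot_mem_simpleOrbit i

/-- Every vector of real type is Weyl group conjugate to a simple root. -/
theorem IsRealType.mem_simpleOrbit {T : AffineType} {x : T.RootLattice} (hx : T.IsRealType x) :
    x ∈ T.simpleOrbit := by
  rcases hx.nonneg_or_nonpos with h | h
  · exact mem_simpleOrbit_of_nonneg (∑ i, x i).toNat x hx h (Int.self_le_toNat _)
  · have := mem_simpleOrbit_of_nonneg (∑ i, (-x) i).toNat (-x) hx.neg
      (fun i => by simpa using h i) (Int.self_le_toNat _)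
    simpa using T.neg_mem_simpleOrbit this

/-- `α_i + r δ` is conjugate to a simple root as soon as `a_i^∨` divides `r a_i`. -/
theorem simpleRoot_add_mem_simpleOrbit (T : AffineType) (i : T.Vertex) (r : ℤ)
    (h : (T.colabel i : ℤ) ∣ r * T.label i) :
    T.simpleRoot i + r • T.delta ∈ T.simpleOrbit := by
  have hq : T.latticeForm (T.simpleRoot i + r • T.delta) (T.simpleRoot i + r • T.delta)
      = 2 * T.halfNorm i := by
    simp only [latticeForm_add_left, latticeForm_add_right, latticeForm_zsmul_left,
      latticeForm_zsmul_right, latticeForm_delta_left, latticeForm_delta_right,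
      latticeForm_simpleRoot_self, mul_zero, add_zero]
  refine IsRealType.mem_simpleOrbit ⟨?_, fun j => ?_⟩
  · rw [hq]
    linarith [T.halfNorm_pos i]
  · rw [hq]
    obtain ⟨z, hz⟩ := h
    have hz' : (r : ℝ) = z * T.halfNorm i := by
      have : (r : ℝ) * T.label i = T.colabel i * z := by exact_mod_cast hz
      have h0 : (T.label i : ℝ) ≠ 0 := Nat.cast_ne_zero.2 (T.label_pos i).ne'
      unfold halfNorm
      field_simp
      linarith
    have e : (((T.simpleRoot i + r • T.delta) j : ℤ) : ℝ) * (2 * T.halfNorm j)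
        = (T.simpleRoot i j : ℝ) * (2 * T.halfNorm j)
          + (T.colabel j * z : ℤ) • (2 * T.halfNorm i) := by
      have := T.label_mul_halfNorm j
      have hc : (T.simpleRoot i + r • T.delta) j = T.simpleRoot i j + r * T.label j := by
        simp [delta]
      rw [hc, zsmul_eq_mul]
      push_cast
      rw [hz', ← this]
      ring
    rw [e]
    refine add_mem ?_ (zsmul_mem (AddSubgroup.mem_zmultiples _) _)
    by_cases hj : j = i
    · subst hj
      simp [simpleRoot]
    · simp [simpleRoot, hj]

/-- The set of real roots is stable under translation by multiples of `k δ`. -/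
theorem add_zsmul_k_delta_mem_simpleOrbit (T : AffineType) {m : T.RootLattice}
    (hm : m ∈ T.simpleOrbit) (r : ℤ) : m + (r * T.k) • T.delta ∈ T.simpleOrbit := by
  obtain ⟨w, hw, i, rfl⟩ := hm
  have hd : (T.colabel i : ℤ) ∣ T.k * T.label i := by exact_mod_cast T.colabel_dvd i
  have := T.map_mem_simpleOrbit hw (T.simpleRoot_add_mem_simpleOrbit i (r * T.k)
    (by rw [mul_assoc]; exact hd.mul_left r))
  rwa [map_add, map_zsmul, T.weylGroup_delta hw] at this

end AffineType

/-! ### Chevalley generators and Serre elements -/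

section Chevalley

variable {ι L : Type*} [LieRing L] [LieAlgebra ℂ L]

/-- The Chevalley relations, without the Serre relations, for a matrix `A`. -/
structure ChevalleyRelations (A : ι → ι → ℤ) (e f h : ι → L) : Prop where
  lie_h_e : ∀ i j, ⁅h i, e j⁆ = (A i j : ℂ) • e j
  lie_h_f : ∀ i j, ⁅h i, f j⁆ = -((A i j : ℂ) • f j)
  lie_e_f : ∀ i, ⁅e i, f i⁆ = h i
  lie_e_f_of_ne : ∀ i j, i ≠ j → ⁅e i, f j⁆ = 0

namespace ChevalleyRelations

variable {A : ι → ι → ℤ} {e f h : ι → L}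

/-- The Chevalley relations are preserved by `e ↔ f`, `h ↦ -h`. -/
theorem swap (H : ChevalleyRelations A e f h) : ChevalleyRelations A f e (fun i => -h i) where
  lie_h_e i j := by rw [neg_lie, H.lie_h_f, neg_neg]
  lie_h_f i j := by rw [neg_lie, H.lie_h_e]
  lie_e_f i := by rw [← lie_skew, H.lie_e_f]
  lie_e_f_of_ne i j hij := by rw [← lie_skew, H.lie_e_f_of_ne j i hij.symm, neg_zero]

theorem isSl2Triple (H : ChevalleyRelations A e f h) {i : ι} (hA : A i i = 2) (hi : h i ≠ 0) :
    IsSl2Triple (h i) (e i) (f i) where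
  h_ne_zero := hi
  lie_e_f := H.lie_e_f i
  lie_h_e_nsmul := by rw [H.lie_h_e, hA, ← Nat.cast_smul_eq_nsmul ℂ]; norm_num
  lie_h_f_nsmul := by rw [H.lie_h_f, hA, ← Nat.cast_smul_eq_nsmul ℂ]; norm_num

theorem lie_f_ad_pow_of_commute {x y z : L} (h : ⁅x, y⁆ = 0) (n : ℕ) :
    ⁅x, (LieAlgebra.ad ℂ L y ^ n) z⁆ = (LieAlgebra.ad ℂ L y ^ n) ⁅x, z⁆ := by
  induction n with
  | zero => simp
  | succ n ih =>
    rw [pow_succ', Module.End.mul_apply, Module.End.mul_apply, LieAlgebra.ad_apply,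
      LieAlgebra.ad_apply, leibniz_lie, h, zero_lie, zero_add, ih]

/-- The Serre element `(ad e_i)^{1 - a_{ij}} e_j` commutes with every `f_k`: for `k = i` this is
`sl₂`-theory, and otherwise `ad f_k` commutes with `ad e_i`. -/
theorem lie_f_serre (H : ChevalleyRelations A e f h) {i j : ι} (hij : i ≠ j) (hA : A i i = 2)
    (hle : A i j ≤ 0) (hzero : A i j = 0 → A j i = 0) (k : ι) :
    ⁅f k, (LieAlgebra.ad ℂ L (e i) ^ (1 - A i j).toNat) (e j)⁆ = 0 := by
  obtain ⟨n, hn⟩ : ∃ n : ℕ, A i j = -n := ⟨(-A i j).toNat, by omega⟩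
  have hN : (1 - A i j).toNat = n + 1 := by omega
  rw [hN]
  by_cases hk : k = i
  · subst hk
    by_cases hh : h k = 0
    · have he : e k = 0 := by
        have := H.lie_h_e k k
        rw [hh, zero_lie, hA] at this
        simpa using this.symm
      simp [he]
    by_cases hj : e j = 0
    · simp [hj]
    have t := (H.isSl2Triple hA hh).symm
    have P : t.HasPrimitiveVectorWith (e j) (n : ℂ) :=
      { ne_zero := hj
        lie_h := by rw [neg_lie, H.lie_h_e, hn]; simp
        lie_e := by rw [← lie_skew, H.lie_e_f_of_ne j k hij.symm, neg_zero] }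
    have := P.lie_e_pow_succ_toEnd_f n
    rw [sub_self, mul_zero, zero_smul] at this
    exact this
  · have hki : ⁅f k, e i⁆ = 0 := by
      rw [← lie_skew, H.lie_e_f_of_ne i k (Ne.symm hk), neg_zero]
    rw [lie_f_ad_pow_of_commute hki]
    by_cases hkj : k = j
    · subst hkj
      have h1 : ⁅f k, e k⁆ = -h k := by rw [← lie_skew, H.lie_e_f]
      have h2 : ⁅e i, -h k⁆ = (A k i : ℂ) • e i := by rw [lie_neg, lie_skew, H.lie_h_e]
      rw [h1, pow_succ, Module.End.mul_apply, LieAlgebra.ad_apply, h2, map_smul]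
      rcases n with _ | n
      · rw [hzero (by simpa using hn)]
        simp
      · rw [pow_succ, Module.End.mul_apply, LieAlgebra.ad_apply, lie_self, map_zero, smul_zero]
    · rw [← lie_skew, H.lie_e_f_of_ne j k (Ne.symm hkj), neg_zero, map_zero]

end ChevalleyRelations

end Chevalley

namespace AffineType

/-! ### A representation on which the generators act nontrivially -/

section WordRepresentation

attribute [local instance] LieRing.ofAssociativeRing

/-- The space of functions on words in the vertices. It carries a coinduced representation: the
value of `φ` at the word `k₁ ⋯ k_r` is the vacuum component of `e_{k_r} ⋯ e_{k₁} φ`. -/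
abbrev WordSpace (T : AffineType) : Type := List T.Vertex → ℂ

/-- The operator of `e_k` on the coinduced representation. -/
def eOp (T : AffineType) (k : T.Vertex) : Module.End ℂ T.WordSpace where
  toFun φ w := φ (k :: w)
  map_add' _ _ := rfl
  map_smul' _ _ := rfl

/-- The eigenvalue `c - ∑_{k ∈ w} μ_k` of a Cartan element on the words `w`. -/
def wordWeight (T : AffineType) (c : ℂ) (μ : T.Vertex → ℂ) (w : List T.Vertex) : ℂ :=
  c - (w.map μ).sum

/-- The diagonal operator with eigenvalue `wordWeight c μ`. -/
def weightOp (T : AffineType) (c : ℂ) (μ : T.Vertex → ℂ) : Module.End ℂ T.WordSpace where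
  toFun φ w := T.wordWeight c μ w * φ w
  map_add' φ ψ := by funext w; simp [mul_add]
  map_smul' r φ := by funext w; simp; ring

/-- The operator of `h_i`, for the highest weight `ρ` with `ρ(h_i) = 1` for all `i`. -/
def hOp (T : AffineType) (i : T.Vertex) : Module.End ℂ T.WordSpace :=
  T.weightOp 1 fun k => T.cartan i k

/-- The function underlying `f_j`. The recursion is `e_k f_j = f_j e_k + δ_{kj} h_j`. -/
def fFun (T : AffineType) (j : T.Vertex) : List T.Vertex → T.WordSpace → ℂ
  | [], _ => 0
  | k :: w, φ => fFun T j w (T.eOp k φ) + if k = j then T.hOp j φ w else 0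

/-- The operator of `f_j` on the coinduced representation. -/
def fOp (T : AffineType) (j : T.Vertex) : Module.End ℂ T.WordSpace where
  toFun φ w := T.fFun j w φ
  map_add' φ ψ := by
    funext w
    induction w generalizing φ ψ with
    | nil => simp [fFun]
    | cons k w ih =>
      have := ih (T.eOp k φ) (T.eOp k ψ)
      simp only [Pi.add_apply] at this
      simp only [fFun, map_add, this, Pi.add_apply]
      split_ifs <;> ring
  map_smul' r φ := by
    funext w
    induction w generalizing φ with
    | nil => simp [fFun]
    | cons k w ih =>
      have := ih (T.eOp k φ)
      simp only [Pi.smul_apply, RingHom.id_apply, smul_eq_mul] at this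
      simp only [fFun, map_smul, this, Pi.smul_apply, RingHom.id_apply, smul_eq_mul]
      split_ifs <;> ring

theorem fOp_nil (T : AffineType) (j : T.Vertex) (φ : T.WordSpace) : T.fOp j φ [] = 0 := rfl

theorem fOp_cons (T : AffineType) (j k : T.Vertex) (w : List T.Vertex) (φ : T.WordSpace) :
    T.fOp j φ (k :: w) = T.fOp j (T.eOp k φ) w + if k = j then T.hOp j φ w else 0 := rfl

theorem wordWeight_cons (T : AffineType) (c : ℂ) (μ : T.Vertex → ℂ) (k : T.Vertex)
    (w : List T.Vertex) : T.wordWeight c μ (k :: w) = T.wordWeight c μ w - μ k := by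
  simp [wordWeight]; ring

theorem lie_weightOp_weightOp (T : AffineType) (c c' : ℂ) (μ μ' : T.Vertex → ℂ) :
    ⁅T.weightOp c μ, T.weightOp c' μ'⁆ = 0 := by
  ext φ w
  simp [LieRing.of_associative_ring_bracket, weightOp]
  ring

theorem lie_weightOp_eOp (T : AffineType) (c : ℂ) (μ : T.Vertex → ℂ) (k : T.Vertex) :
    ⁅T.weightOp c μ, T.eOp k⁆ = μ k • T.eOp k := by
  ext φ w
  simp [LieRing.of_associative_ring_bracket, weightOp, eOp, wordWeight_cons]
  ring

theorem fOp_weightOp (T : AffineType) (c : ℂ) (μ : T.Vertex → ℂ) (j : T.Vertex)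
    (w : List T.Vertex) (φ : T.WordSpace) :
    T.fOp j (T.weightOp c μ φ) w = (T.wordWeight c μ w + μ j) * T.fOp j φ w := by
  induction w generalizing φ with
  | nil => simp [fOp_nil]
  | cons k w ih =>
    have hk : T.eOp k (T.weightOp c μ φ)
        = T.weightOp c μ (T.eOp k φ) - μ k • T.eOp k φ := by
      have := congrArg (fun X : Module.End ℂ T.WordSpace => X φ) (T.lie_weightOp_eOp c μ k)
      simp only [LieRing.of_associative_ring_bracket, LinearMap.sub_apply, Module.End.mul_apply,
        LinearMap.smul_apply] at this
      rw [← this, sub_sub_cancel]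
    rw [fOp_cons, fOp_cons, hk, map_sub, map_smul, Pi.sub_apply, Pi.smul_apply, ih,
      wordWeight_cons]
    split_ifs with h
    · subst h
      simp [hOp, weightOp]
      ring
    · simp
      ring

theorem lie_weightOp_fOp (T : AffineType) (c : ℂ) (μ : T.Vertex → ℂ) (j : T.Vertex) :
    ⁅T.weightOp c μ, T.fOp j⁆ = -(μ j • T.fOp j) := by
  ext φ w
  simp only [LieRing.of_associative_ring_bracket, LinearMap.sub_apply, Module.End.mul_apply,
    LinearMap.neg_apply, LinearMap.smul_apply, Pi.sub_apply, Pi.neg_apply, Pi.smul_apply,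
    fOp_weightOp]
  simp [weightOp]
  ring

theorem lie_eOp_fOp (T : AffineType) (k j : T.Vertex) :
    ⁅T.eOp k, T.fOp j⁆ = if k = j then T.hOp j else 0 := by
  ext φ w
  simp only [LieRing.of_associative_ring_bracket, LinearMap.sub_apply, Module.End.mul_apply,
    Pi.sub_apply]
  have : T.eOp k (T.fOp j φ) w = T.fOp j φ (k :: w) := rfl
  rw [this, fOp_cons]
  split_ifs <;> simp

theorem chevalleyRelations_op (T : AffineType) :
    ChevalleyRelations T.cartan T.eOp T.fOp T.hOp where
  lie_h_e i j := T.lie_weightOp_eOp _ _ _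
  lie_h_f i j := T.lie_weightOp_fOp _ _ _
  lie_e_f i := by simp [lie_eOp_fOp]
  lie_e_f_of_ne i j hij := by simp [lie_eOp_fOp, hij]

theorem cartan_eq_zero_symm (T : AffineType) {i j : T.Vertex} (h : T.cartan i j = 0) :
    T.cartan j i = 0 := by
  have := T.cartan_symm i j
  rw [h, mul_zero, eq_comm, mul_eq_zero] at this
  refine this.resolve_left (mul_ne_zero ?_ ?_)
  · exact_mod_cast (T.colabel_pos j).ne'
  · exact_mod_cast (T.label_pos i).ne'

/-- An operator commuting with all `e_k` whose values have no vacuum component is zero. -/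
theorem eq_zero_of_lie_eOp (T : AffineType) (X : Module.End ℂ T.WordSpace)
    (hX : ∀ k, ⁅T.eOp k, X⁆ = 0) (hnil : ∀ φ, X φ [] = 0) : X = 0 := by
  ext φ w
  induction w generalizing φ with
  | nil => exact hnil φ
  | cons k w ih =>
    have := congrArg (fun Y : Module.End ℂ T.WordSpace => Y φ) (hX k)
    simp only [LieRing.of_associative_ring_bracket, LinearMap.sub_apply, Module.End.mul_apply,
      LinearMap.zero_apply, sub_eq_zero] at this
    have h2 : X φ (k :: w) = T.eOp k (X φ) w := rfl
    rw [h2, this]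
    exact ih _

/-- The Serre elements in the `f_i` act by zero on the coinduced representation. -/
theorem serre_fOp (T : AffineType) {i j : T.Vertex} (hij : i ≠ j) :
    (LieAlgebra.ad ℂ (Module.End ℂ T.WordSpace) (T.fOp i) ^ (1 - T.cartan i j).toNat)
      (T.fOp j) = 0 := by
  refine T.eq_zero_of_lie_eOp _ (fun k => T.chevalleyRelations_op.swap.lie_f_serre hij
    (T.cartan_diag i) (T.cartan_nonpos hij) T.cartan_eq_zero_symm k) ?_
  generalize (1 - T.cartan i j).toNat = n
  induction n with
  | zero => exact fun φ => rfl
  | succ n ih =>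
    intro φ
    rw [pow_succ', Module.End.mul_apply, LieAlgebra.ad_apply,
      LieRing.of_associative_ring_bracket, LinearMap.sub_apply, Module.End.mul_apply,
      Module.End.mul_apply, Pi.sub_apply, fOp_nil, ih, sub_zero]

/-- The highest weight vector: the indicator function of the empty word. -/
def vacuum (T : AffineType) : T.WordSpace := Pi.single [] 1

theorem eOp_vacuum (T : AffineType) (k : T.Vertex) : T.eOp k T.vacuum = 0 := by
  funext w
  simp [eOp, vacuum]

theorem weightOp_vacuum (T : AffineType) (c : ℂ) (μ : T.Vertex → ℂ) :
    T.weightOp c μ T.vacuum = c • T.vacuum := by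
  funext w
  cases w <;> simp [weightOp, vacuum, wordWeight]

/-- The highest weight module: the span of the vectors `f_{j₁} ⋯ f_{j_r} v`, where `v` is the
highest weight vector. -/
def vacuumModule (T : AffineType) : Submodule ℂ T.WordSpace :=
  Submodule.span ℂ (Set.range fun w : List T.Vertex => w.foldr (fun j φ => T.fOp j φ) T.vacuum)

theorem vacuum_mem (T : AffineType) : T.vacuum ∈ T.vacuumModule :=
  Submodule.subset_span ⟨[], rfl⟩

theorem vacuumModule_le_of {T : AffineType} {S : Submodule ℂ T.WordSpace} (h0 : T.vacuum ∈ S)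
    (hf : ∀ j, ∀ φ ∈ T.vacuumModule, φ ∈ S → T.fOp j φ ∈ S) : T.vacuumModule ≤ S := by
  rw [vacuumModule, Submodule.span_le]
  rintro _ ⟨w, rfl⟩
  induction w with
  | nil => exact h0
  | cons j w ih => exact hf j _ (Submodule.subset_span ⟨w, rfl⟩) ih

theorem fOp_mem_vacuumModule (T : AffineType) (j : T.Vertex) {φ : T.WordSpace}
    (h : φ ∈ T.vacuumModule) : T.fOp j φ ∈ T.vacuumModule := by
  have : T.vacuumModule ≤ T.vacuumModule.comap (T.fOp j) := by
    conv_lhs => rw [vacuumModule]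
    rw [Submodule.span_le]
    rintro _ ⟨w, rfl⟩
    exact Submodule.subset_span ⟨j :: w, rfl⟩
  exact this h

theorem weightOp_mem_vacuumModule (T : AffineType) (c : ℂ) (μ : T.Vertex → ℂ) {φ : T.WordSpace}
    (h : φ ∈ T.vacuumModule) : T.weightOp c μ φ ∈ T.vacuumModule := by
  refine vacuumModule_le_of (S := T.vacuumModule.comap (T.weightOp c μ)) ?_ ?_ h
  · rw [Submodule.mem_comap, weightOp_vacuum]
    exact Submodule.smul_mem _ _ T.vacuum_mem
  · intro j φ hφ hS
    have := congrArg (fun Y : Module.End ℂ T.WordSpace => Y φ) (T.lie_weightOp_fOp c μ j)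
    simp only [LieRing.of_associative_ring_bracket, LinearMap.sub_apply, Module.End.mul_apply,
      LinearMap.neg_apply, LinearMap.smul_apply] at this
    rw [Submodule.mem_comap, sub_eq_iff_eq_add.1 this]
    exact add_mem (neg_mem (Submodule.smul_mem _ _ (T.fOp_mem_vacuumModule j hφ)))
      (T.fOp_mem_vacuumModule j hS)

theorem eOp_mem_vacuumModule (T : AffineType) (k : T.Vertex) {φ : T.WordSpace}
    (h : φ ∈ T.vacuumModule) : T.eOp k φ ∈ T.vacuumModule := by
  refine vacuumModule_le_of (S := T.vacuumModule.comap (T.eOp k)) ?_ ?_ h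
  · rw [Submodule.mem_comap, eOp_vacuum]
    exact zero_mem _
  · intro j φ hφ hS
    have := congrArg (fun Y : Module.End ℂ T.WordSpace => Y φ) (T.lie_eOp_fOp k j)
    simp only [LieRing.of_associative_ring_bracket, LinearMap.sub_apply,
      Module.End.mul_apply] at this
    rw [Submodule.mem_comap, sub_eq_iff_eq_add.1 this]
    refine add_mem ?_ (T.fOp_mem_vacuumModule j hS)
    split_ifs
    · exact T.weightOp_mem_vacuumModule _ _ hφ
    · exact zero_mem _

/-- The Serre elements in the `e_i` act by zero on the highest weight module. -/
theorem serre_eOp (T : AffineType) {i j : T.Vertex} (hij : i ≠ j) {φ : T.WordSpace}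
    (h : φ ∈ T.vacuumModule) :
    (LieAlgebra.ad ℂ (Module.End ℂ T.WordSpace) (T.eOp i) ^ (1 - T.cartan i j).toNat)
      (T.eOp j) φ = 0 := by
  have hcomm := T.chevalleyRelations_op.lie_f_serre hij (T.cartan_diag i) (T.cartan_nonpos hij)
    T.cartan_eq_zero_symm
  have hvac : (LieAlgebra.ad ℂ (Module.End ℂ T.WordSpace) (T.eOp i)
      ^ (1 - T.cartan i j).toNat) (T.eOp j) T.vacuum = 0 := by
    generalize (1 - T.cartan i j).toNat = n
    induction n with
    | zero => exact T.eOp_vacuum j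
    | succ n ih =>
      rw [pow_succ', Module.End.mul_apply, LieAlgebra.ad_apply,
        LieRing.of_associative_ring_bracket, LinearMap.sub_apply, Module.End.mul_apply,
        Module.End.mul_apply, ih, eOp_vacuum, map_zero, map_zero, sub_zero]
  generalize (LieAlgebra.ad ℂ (Module.End ℂ T.WordSpace) (T.eOp i)
      ^ (1 - T.cartan i j).toNat) (T.eOp j) = X at hcomm hvac
  refine vacuumModule_le_of (S := LinearMap.ker X) hvac (fun k ψ _ hψ => ?_) h
  have := congrArg (fun Y : Module.End ℂ T.WordSpace => Y ψ) (hcomm k)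
  simp only [LieRing.of_associative_ring_bracket, LinearMap.sub_apply, Module.End.mul_apply,
    LinearMap.zero_apply, sub_eq_zero] at this
  rw [LinearMap.mem_ker] at hψ ⊢
  rw [← this, hψ, map_zero]

/-- The representation of the free Lie algebra on functions on words. -/
noncomputable def wordRep (T : AffineType) :
    FreeLieAlgebra ℂ T.Gen →ₗ⁅ℂ⁆ Module.End ℂ T.WordSpace :=
  FreeLieAlgebra.lift ℂ fun x => match x with
    | .e i => T.eOp i
    | .f i => T.fOp i
    | .h i => T.hOp i
    | .d => T.weightOp 0 fun k => if k = 0 then 1 else 0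

theorem wordRep_e (T : AffineType) (i : T.Vertex) : T.wordRep (T.free (.e i)) = T.eOp i :=
  FreeLieAlgebra.lift_of_apply ..

theorem wordRep_f (T : AffineType) (i : T.Vertex) : T.wordRep (T.free (.f i)) = T.fOp i :=
  FreeLieAlgebra.lift_of_apply ..

theorem wordRep_h (T : AffineType) (i : T.Vertex) : T.wordRep (T.free (.h i)) = T.hOp i :=
  FreeLieAlgebra.lift_of_apply ..

theorem wordRep_d (T : AffineType) :
    T.wordRep (T.free .d) = T.weightOp 0 fun k => if k = 0 then 1 else 0 :=
  FreeLieAlgebra.lift_of_apply ..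

theorem _root_.FreeLieAlgebra.mem_of_forall_of_mem {X : Type*}
    (S : LieSubalgebra ℂ (FreeLieAlgebra ℂ X)) (h : ∀ x, FreeLieAlgebra.of ℂ x ∈ S)
    (y : FreeLieAlgebra ℂ X) : y ∈ S := by
  let F : FreeLieAlgebra ℂ X →ₗ⁅ℂ⁆ S := FreeLieAlgebra.lift ℂ fun x => ⟨FreeLieAlgebra.of ℂ x, h x⟩
  have hF : S.incl.comp F = LieHom.id :=
    FreeLieAlgebra.hom_ext fun x => by simp [F, FreeLieAlgebra.lift_of_apply]
  have := congrArg (fun G : FreeLieAlgebra ℂ X →ₗ⁅ℂ⁆ FreeLieAlgebra ℂ X => G y) hF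
  simp only [LieHom.comp_apply, LieHom.coe_id, id_eq] at this
  rw [← this]
  exact (F y).2

theorem wordRep_mem_vacuumModule (T : AffineType) (X : FreeLieAlgebra ℂ T.Gen) :
    ∀ φ ∈ T.vacuumModule, T.wordRep X φ ∈ T.vacuumModule := by
  let S : LieSubalgebra ℂ (FreeLieAlgebra ℂ T.Gen) :=
    { carrier := {X | ∀ φ ∈ T.vacuumModule, T.wordRep X φ ∈ T.vacuumModule}
      zero_mem' := fun φ _ => by simp
      add_mem' := fun {X Y} hX hY φ hφ => by
        rw [map_add]; exact add_mem (hX φ hφ) (hY φ hφ)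
      smul_mem' := fun c X hX φ hφ => by
        rw [map_smul]; exact Submodule.smul_mem _ _ (hX φ hφ)
      lie_mem' := fun {X Y} hX hY φ hφ => by
        rw [LieHom.map_lie, LieRing.of_associative_ring_bracket]
        exact sub_mem (hX _ (hY φ hφ)) (hY _ (hX φ hφ)) }
  refine FreeLieAlgebra.mem_of_forall_of_mem S (fun x φ hφ => ?_) X
  cases x with
  | e i => rw [T.wordRep_e]; exact T.eOp_mem_vacuumModule i hφ
  | f i => rw [T.wordRep_f]; exact T.fOp_mem_vacuumModule i hφ
  | h i => rw [T.wordRep_h]; exact T.weightOp_mem_vacuumModule _ _ hφ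
  | d => rw [T.wordRep_d]; exact T.weightOp_mem_vacuumModule _ _ hφ

theorem wordRep_ad_pow (T : AffineType) (x y : FreeLieAlgebra ℂ T.Gen) (n : ℕ) :
    T.wordRep ((LieAlgebra.ad ℂ _ x ^ n) y)
      = (LieAlgebra.ad ℂ _ (T.wordRep x) ^ n) (T.wordRep y) := by
  induction n with
  | zero => rfl
  | succ n ih =>
    rw [pow_succ', pow_succ', Module.End.mul_apply, Module.End.mul_apply, LieAlgebra.ad_apply,
      LieAlgebra.ad_apply, LieHom.map_lie, ih]

/-- The annihilator of the highest weight module. -/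
noncomputable def vacuumAnnihilator (T : AffineType) : LieIdeal ℂ (FreeLieAlgebra ℂ T.Gen) where
  carrier := {X | ∀ φ ∈ T.vacuumModule, T.wordRep X φ = 0}
  zero_mem' φ _ := by simp
  add_mem' {X Y} hX hY φ hφ := by simp [hX φ hφ, hY φ hφ]
  smul_mem' c X hX φ hφ := by simp [hX φ hφ]
  lie_mem {X Y} hY φ hφ := by
    rw [LieHom.map_lie, LieRing.of_associative_ring_bracket, LinearMap.sub_apply,
      Module.End.mul_apply, Module.End.mul_apply, hY φ hφ,
      hY _ (T.wordRep_mem_vacuumModule X φ hφ), map_zero, sub_zero]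

theorem relationIdeal_le_vacuumAnnihilator (T : AffineType) :
    T.relationIdeal ≤ T.vacuumAnnihilator := by
  have C := T.chevalleyRelations_op
  rw [relationIdeal, LieSubmodule.lieSpan_le]
  intro X hX φ hφ
  cases hX with
  | hh i j =>
    rw [LieHom.map_lie, wordRep_h, wordRep_h, hOp, hOp, lie_weightOp_weightOp]; rfl
  | dh i => rw [LieHom.map_lie, wordRep_h, wordRep_d, hOp, lie_weightOp_weightOp]; rfl
  | he i j =>
    rw [map_sub, map_smul, LieHom.map_lie, wordRep_h, wordRep_e, C.lie_h_e, sub_self]; rfl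
  | hf i j =>
    rw [map_add, map_smul, LieHom.map_lie, wordRep_h, wordRep_f, C.lie_h_f, neg_add_cancel]; rfl
  | de j =>
    rw [map_sub, map_smul, LieHom.map_lie, wordRep_d, wordRep_e, lie_weightOp_eOp, sub_self]; rfl
  | df j =>
    rw [map_add, map_smul, LieHom.map_lie, wordRep_d, wordRep_f, lie_weightOp_fOp,
      neg_add_cancel]; rfl
  | ef_same i =>
    rw [map_sub, LieHom.map_lie, wordRep_e, wordRep_f, wordRep_h, C.lie_e_f, sub_self]; rfl
  | ef_ne i j hij => rw [LieHom.map_lie, wordRep_e, wordRep_f, C.lie_e_f_of_ne i j hij]; rfl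
  | serre_e i j hij => rw [wordRep_ad_pow, wordRep_e, wordRep_e]; exact T.serre_eOp hij hφ
  | serre_f i j hij => rw [wordRep_ad_pow, wordRep_f, wordRep_f, T.serre_fOp hij]; rfl

theorem gen_h_ne_zero (T : AffineType) (i : T.Vertex) : T.gen (.h i) ≠ 0 := by
  intro h0
  have hmem : T.free (.h i) ∈ T.relationIdeal :=
    (LieSubmodule.Quotient.mk_eq_zero').1 h0
  have := T.relationIdeal_le_vacuumAnnihilator hmem T.vacuum T.vacuum_mem
  rw [wordRep_h, hOp, weightOp_vacuum, one_smul] at this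
  have h1 := congrFun this []
  simp [vacuum] at h1

end WordRepresentation

end AffineType

/-! ### Spanning by iterated brackets -/

section NestedBrackets

variable {ι L : Type*} [DecidableEq ι] [LieRing L]

/-- `NestedBracket g m x` says that `x` is an iterated bracket `[g_{i₁}, [g_{i₂}, … g_{i_r}]]`,
`r ≥ 1`, in which `i` occurs `m i` times. -/
inductive NestedBracket (g : ι → L) : (ι → ℤ) → L → Prop
  | base (i : ι) : NestedBracket g (Pi.single i 1) (g i)
  | step (i : ι) (m : ι → ℤ) (x : L) (hx : NestedBracket g m x) :
      NestedBracket g (m + Pi.single i 1) ⁅g i, x⁆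

theorem NestedBracket.nonneg {g : ι → L} {m : ι → ℤ} {x : L} (h : NestedBracket g m x) :
    0 ≤ m := by
  induction h with
  | base i => exact Pi.single_nonneg.2 zero_le_one
  | step i m x _ ih => exact add_nonneg ih (Pi.single_nonneg.2 zero_le_one)

/-- Brackets in a single generator vanish, apart from the generator itself. -/
theorem NestedBracket.eq_zero_or_eq_single {g : ι → L} {m : ι → ℤ} {x : L}
    (h : NestedBracket g m x) {i : ι} (hi : ∀ j, j ≠ i → m j = 0) :
    x = 0 ∨ (x = g i ∧ m = Pi.single i 1) := by
  induction h with
  | base j =>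
    by_cases hj : j = i
    · subst hj; exact Or.inr ⟨rfl, rfl⟩
    · have := hi j hj
      simp at this
  | step j m x hx ih =>
    have hm := hx.nonneg
    by_cases hj : j = i
    · subst hj
      left
      rcases ih fun l hl => by simpa [hl] using hi l hl with rfl | ⟨rfl, -⟩
      · exact lie_zero _
      · exact lie_self _
    · have h1 := hi j hj
      have h2 := hm j
      simp only [Pi.add_apply, Pi.single_eq_same, Pi.zero_apply] at h1 h2
      omega

variable [LieAlgebra ℂ L]

/-- The span of the iterated brackets of the `g_i`. -/
def nestedSpan (g : ι → L) : Submodule ℂ L :=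
  Submodule.span ℂ {x | ∃ m, NestedBracket g m x}

theorem lie_mem_nestedSpan (g : ι → L) (i : ι) {x : L} (hx : x ∈ nestedSpan g) :
    ⁅g i, x⁆ ∈ nestedSpan g := by
  have : nestedSpan g ≤ (nestedSpan g).comap (LieAlgebra.ad ℂ L (g i)) := by
    conv_lhs => rw [nestedSpan]
    rw [Submodule.span_le]
    rintro y ⟨m, hy⟩
    exact Submodule.subset_span ⟨_, hy.step i⟩
  exact this hx

theorem lie_mem_nestedSpan_of_eigen {g : ι → L} {z : L} (hz : ∀ j, ∃ c : ℂ, ⁅z, g j⁆ = c • g j)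
    {x : L} (hx : x ∈ nestedSpan g) : ⁅z, x⁆ ∈ nestedSpan g := by
  have : nestedSpan g ≤ (nestedSpan g).comap (LieAlgebra.ad ℂ L z) := by
    conv_lhs => rw [nestedSpan]
    rw [Submodule.span_le]
    rintro y ⟨m, hy⟩
    suffices ∃ c : ℂ, ⁅z, y⁆ = c • y by
      obtain ⟨c, hc⟩ := this
      change ⁅z, y⁆ ∈ nestedSpan g
      rw [hc]
      exact Submodule.smul_mem _ _ (Submodule.subset_span ⟨m, hy⟩)
    induction hy with
    | base j => exact hz j
    | step j m y _ ih =>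
      obtain ⟨c, hc⟩ := ih
      obtain ⟨d, hd⟩ := hz j
      exact ⟨d + c, by rw [leibniz_lie, hc, hd, smul_lie, lie_smul, add_smul]⟩
  exact this hx

/-- The generators `e_i` map the span of the iterated brackets of the `f_j` and a Cartan subspace
`S` to itself. -/
theorem ChevalleyRelations.lie_e_mem_sup {A : ι → ι → ℤ} {e f h : ι → L}
    (H : ChevalleyRelations A e f h) {S : Submodule ℂ L} (hS : ∀ i, h i ∈ S)
    (hf : ∀ z ∈ S, ∀ j, ∃ c : ℂ, ⁅z, f j⁆ = c • f j) (i : ι) {x : L} (hx : x ∈ nestedSpan f) :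
    ⁅e i, x⁆ ∈ nestedSpan f ⊔ S := by
  have hstab : ∀ j, ∀ y ∈ nestedSpan f ⊔ S, ⁅f j, y⁆ ∈ nestedSpan f := by
    intro j y hy
    obtain ⟨a, ha, z, hz, rfl⟩ := Submodule.mem_sup.1 hy
    rw [lie_add]
    refine add_mem (lie_mem_nestedSpan f j ha) ?_
    obtain ⟨c, hc⟩ := hf z hz j
    rw [← lie_skew, hc]
    exact neg_mem (Submodule.smul_mem _ _ (Submodule.subset_span ⟨_, .base j⟩))
  have : nestedSpan f ≤ (nestedSpan f ⊔ S).comap (LieAlgebra.ad ℂ L (e i)) := by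
    conv_lhs => rw [nestedSpan]
    rw [Submodule.span_le]
    rintro y ⟨m, hy⟩
    change ⁅e i, y⁆ ∈ nestedSpan f ⊔ S
    have hef : ∀ j, ⁅e i, f j⁆ ∈ S := fun j => by
      by_cases hij : i = j
      · subst hij; rw [H.lie_e_f]; exact hS i
      · rw [H.lie_e_f_of_ne i j hij]; exact zero_mem _
    induction hy with
    | base j => exact Submodule.mem_sup_right (hef j)
    | step j m y hy ih =>
      rw [leibniz_lie]
      refine Submodule.mem_sup_left (add_mem ?_ (hstab j _ ih))
      exact lie_mem_nestedSpan_of_eigen (hf _ (hef j)) (Submodule.subset_span ⟨m, hy⟩)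
  exact this hx

end NestedBrackets

namespace AffineType

/-! ### The Kac–Moody algebra -/

/-- The quotient map as a morphism of Lie algebras. -/
noncomputable def quotientHom (T : AffineType) : FreeLieAlgebra ℂ T.Gen →ₗ⁅ℂ⁆ T.KacMoody where
  toFun x := LieSubmodule.Quotient.mk x
  map_add' _ _ := rfl
  map_smul' _ _ := rfl
  map_lie' := rfl

theorem quotientHom_surjective (T : AffineType) : Function.Surjective T.quotientHom :=
  LieSubmodule.Quotient.surjective_mk' T.relationIdeal

theorem quotientHom_eq_zero (T : AffineType) {x : FreeLieAlgebra ℂ T.Gen} (h : T.Relation x) :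
    T.quotientHom x = 0 :=
  (LieSubmodule.Quotient.mk_eq_zero').2 (LieSubmodule.subset_lieSpan h)

/-- A Lie subalgebra of `ĝ` containing the generators is everything. -/
theorem mem_of_forall_gen_mem {T : AffineType} (S : LieSubalgebra ℂ T.KacMoody)
    (h : ∀ x, T.gen x ∈ S) (y : T.KacMoody) : y ∈ S := by
  obtain ⟨y, rfl⟩ := T.quotientHom_surjective y
  exact FreeLieAlgebra.mem_of_forall_of_mem (S.comap T.quotientHom) h y

theorem quotientHom_ad_pow (T : AffineType) (x y : FreeLieAlgebra ℂ T.Gen) (n : ℕ) :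
    T.quotientHom ((LieAlgebra.ad ℂ _ x ^ n) y)
      = (LieAlgebra.ad ℂ _ (T.quotientHom x) ^ n) (T.quotientHom y) := by
  induction n with
  | zero => rfl
  | succ n ih =>
    rw [pow_succ', pow_succ', Module.End.mul_apply, Module.End.mul_apply, LieAlgebra.ad_apply,
      LieAlgebra.ad_apply, LieHom.map_lie, ih]

theorem lie_gen_h_h (T : AffineType) (i j : T.Vertex) : ⁅T.gen (.h i), T.gen (.h j)⁆ = 0 :=
  T.quotientHom_eq_zero (.hh i j)

theorem lie_gen_d_h (T : AffineType) (i : T.Vertex) : ⁅T.gen .d, T.gen (.h i)⁆ = 0 :=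
  T.quotientHom_eq_zero (.dh i)

theorem lie_gen_d_e (T : AffineType) (j : T.Vertex) :
    ⁅T.gen .d, T.gen (.e j)⁆ = (if j = 0 then (1 : ℂ) else 0) • T.gen (.e j) :=
  sub_eq_zero.1 (T.quotientHom_eq_zero (.de j))

theorem lie_gen_d_f (T : AffineType) (j : T.Vertex) :
    ⁅T.gen .d, T.gen (.f j)⁆ = -((if j = 0 then (1 : ℂ) else 0) • T.gen (.f j)) :=
  eq_neg_of_add_eq_zero_left (T.quotientHom_eq_zero (.df j))

theorem chevalleyRelations_gen (T : AffineType) :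
    ChevalleyRelations T.cartan (fun i => T.gen (.e i)) (fun i => T.gen (.f i))
      (fun i => T.gen (.h i)) where
  lie_h_e i j := sub_eq_zero.1 (T.quotientHom_eq_zero (.he i j))
  lie_h_f i j := eq_neg_of_add_eq_zero_left (T.quotientHom_eq_zero (.hf i j))
  lie_e_f i := sub_eq_zero.1 (T.quotientHom_eq_zero (.ef_same i))
  lie_e_f_of_ne i j hij := T.quotientHom_eq_zero (.ef_ne i j hij)

theorem isSl2Triple_gen (T : AffineType) (i : T.Vertex) :
    IsSl2Triple (T.gen (.h i)) (T.gen (.e i)) (T.gen (.f i)) :=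
  T.chevalleyRelations_gen.isSl2Triple (T.cartan_diag i) (T.gen_h_ne_zero i)

theorem ad_gen_e_nilpotent (T : AffineType) (i : T.Vertex) (x : T.KacMoody) :
    ∃ n : ℕ, (LieAlgebra.ad ℂ _ (T.gen (.e i)) ^ n) x = 0 := by
  have C := T.chevalleyRelations_gen
  rw [← LieSubalgebra.mem_engel_iff]
  refine mem_of_forall_gen_mem (LieSubalgebra.engel ℂ (T.gen (.e i))) (fun y => ?_) x
  rw [LieSubalgebra.mem_engel_iff]
  cases y with
  | e j =>
    by_cases hij : i = j
    · subst hij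
      exact ⟨1, by simp⟩
    · refine ⟨(1 - T.cartan i j).toNat, ?_⟩
      have := T.quotientHom_eq_zero (.serre_e i j hij)
      rwa [quotientHom_ad_pow] at this
  | f j =>
    by_cases hij : i = j
    · subst hij
      refine ⟨3, ?_⟩
      have h2 : ⁅T.gen (.e i), T.gen (.f i)⁆ = T.gen (.h i) := C.lie_e_f i
      have h3 : ⁅T.gen (.h i), T.gen (.e i)⁆ = (T.cartan i i : ℂ) • T.gen (.e i) := C.lie_h_e i i
      have h4 : ⁅T.gen (.e i), T.gen (.h i)⁆ = -((T.cartan i i : ℂ) • T.gen (.e i)) := by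
        rw [← lie_skew, h3]
      simp [pow_succ, h2, h4]
    · exact ⟨1, by simpa using C.lie_e_f_of_ne i j hij⟩
  | h j =>
    have h3 : ⁅T.gen (.h j), T.gen (.e i)⁆ = (T.cartan j i : ℂ) • T.gen (.e i) := C.lie_h_e j i
    have h4 : ⁅T.gen (.e i), T.gen (.h j)⁆ = -((T.cartan j i : ℂ) • T.gen (.e i)) := by
      rw [← lie_skew, h3]
    exact ⟨2, by simp [pow_succ, h4]⟩
  | d =>
    have h4 : ⁅T.gen (.e i), T.gen .d⁆ = -((if i = 0 then (1 : ℂ) else 0) • T.gen (.e i)) := by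
      rw [← lie_skew, lie_gen_d_e]
    refine ⟨2, ?_⟩
    simp only [pow_succ, pow_zero, one_mul, Module.End.mul_apply, LieAlgebra.ad_apply, h4,
      lie_neg, lie_smul, lie_self, smul_zero, neg_zero]

theorem ad_gen_f_nilpotent (T : AffineType) (i : T.Vertex) (x : T.KacMoody) :
    ∃ n : ℕ, (LieAlgebra.ad ℂ _ (T.gen (.f i)) ^ n) x = 0 := by
  have C := T.chevalleyRelations_gen.swap
  rw [← LieSubalgebra.mem_engel_iff]
  refine mem_of_forall_gen_mem (LieSubalgebra.engel ℂ (T.gen (.f i))) (fun y => ?_) x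
  rw [LieSubalgebra.mem_engel_iff]
  have h4 : ∀ j, ⁅T.gen (.f i), T.gen (.h j)⁆ = (T.cartan j i : ℂ) • T.gen (.f i) := fun j => by
    rw [← lie_skew, ← neg_lie]
    exact C.lie_h_e j i
  cases y with
  | f j =>
    by_cases hij : i = j
    · subst hij
      exact ⟨1, by simp⟩
    · refine ⟨(1 - T.cartan i j).toNat, ?_⟩
      have := T.quotientHom_eq_zero (.serre_f i j hij)
      rwa [quotientHom_ad_pow] at this
  | e j =>
    by_cases hij : i = j
    · subst hij
      refine ⟨3, ?_⟩
      have h2 : ⁅T.gen (.f i), T.gen (.e i)⁆ = -T.gen (.h i) := C.lie_e_f i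
      simp [pow_succ, h2, h4]
    · exact ⟨1, by simpa using C.lie_e_f_of_ne i j hij⟩
  | h j => exact ⟨2, by simp [pow_succ, h4]⟩
  | d =>
    have h4 : ⁅T.gen (.f i), T.gen .d⁆ = (if i = 0 then (1 : ℂ) else 0) • T.gen (.f i) := by
      rw [← lie_skew, lie_gen_d_f, neg_neg]
    refine ⟨2, ?_⟩
    simp only [pow_succ, pow_zero, one_mul, Module.End.mul_apply, LieAlgebra.ad_apply, h4,
      lie_smul, lie_self, smul_zero]

/-! ### Root spaces -/

theorem lie_mem_rootSpace (T : AffineType) {m m' : T.RootLattice} {x y : T.KacMoody}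
    (hx : x ∈ T.rootSpace m) (hy : y ∈ T.rootSpace m') : ⁅x, y⁆ ∈ T.rootSpace (m + m') := by
  refine ⟨fun i => ?_, ?_⟩
  · rw [leibniz_lie, hx.1, hy.1, smul_lie, lie_smul, ← add_smul, map_add, Int.cast_add]
  · rw [leibniz_lie, hx.2, hy.2, smul_lie, lie_smul, ← add_smul, Pi.add_apply, Int.cast_add]

theorem gen_e_mem_rootSpace (T : AffineType) (i : T.Vertex) :
    T.gen (.e i) ∈ T.rootSpace (T.simpleRoot i) := by
  refine ⟨fun j => ?_, ?_⟩
  · rw [coroot_simpleRoot]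
    exact T.chevalleyRelations_gen.lie_h_e j i
  · rw [lie_gen_d_e]
    by_cases h : i = 0
    · subst h; simp [simpleRoot]
    · simp [simpleRoot, h, Ne.symm h]

theorem gen_f_mem_rootSpace (T : AffineType) (i : T.Vertex) :
    T.gen (.f i) ∈ T.rootSpace (-T.simpleRoot i) := by
  refine ⟨fun j => ?_, ?_⟩
  · rw [map_neg, coroot_simpleRoot, Int.cast_neg, neg_smul]
    exact T.chevalleyRelations_gen.lie_h_f j i
  · rw [lie_gen_d_f]
    by_cases h : i = 0
    · subst h; simp [simpleRoot]
    · simp [simpleRoot, h, Ne.symm h]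

theorem nestedBracket_e_mem_rootSpace (T : AffineType) {m : T.RootLattice} {x : T.KacMoody}
    (h : NestedBracket (fun i => T.gen (.e i)) m x) : x ∈ T.rootSpace m := by
  induction h with
  | base i => exact T.gen_e_mem_rootSpace i
  | step i m x _ ih =>
    rw [add_comm]
    exact T.lie_mem_rootSpace (T.gen_e_mem_rootSpace i) ih

theorem nestedBracket_f_mem_rootSpace (T : AffineType) {m : T.RootLattice} {x : T.KacMoody}
    (h : NestedBracket (fun i => T.gen (.f i)) m x) : x ∈ T.rootSpace (-m) := by
  induction h with
  | base i => exact T.gen_f_mem_rootSpace i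
  | step i m x _ ih =>
    rw [neg_add_rev]
    exact T.lie_mem_rootSpace (T.gen_f_mem_rootSpace i) ih

/-- The image of the Cartan subalgebra. -/
noncomputable def cartanSpan (T : AffineType) : Submodule ℂ T.KacMoody :=
  Submodule.span ℂ (insert (T.gen .d) (Set.range fun i => T.gen (.h i)))

theorem gen_d_mem_cartanSpan (T : AffineType) : T.gen .d ∈ T.cartanSpan :=
  Submodule.subset_span (Set.mem_insert _ _)

theorem gen_h_mem_cartanSpan (T : AffineType) (i : T.Vertex) : T.gen (.h i) ∈ T.cartanSpan :=
  Submodule.subset_span (Set.mem_insert_of_mem _ ⟨i, rfl⟩)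

theorem lie_cartanSpan (T : AffineType) {m : T.RootLattice} {x : T.KacMoody}
    (hx : x ∈ T.rootSpace m) : ∀ z ∈ T.cartanSpan, ∃ c : ℂ, ⁅z, x⁆ = c • x := by
  intro z hz
  induction hz using Submodule.span_induction with
  | mem z hz =>
    rcases hz with rfl | ⟨i, rfl⟩
    · exact ⟨_, hx.2⟩
    · exact ⟨_, hx.1 i⟩
  | zero => exact ⟨0, by simp⟩
  | add z w _ _ hz hw =>
    obtain ⟨c, hc⟩ := hz
    obtain ⟨d, hd⟩ := hw
    exact ⟨c + d, by rw [add_lie, hc, hd, add_smul]⟩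
  | smul r z _ hz =>
    obtain ⟨c, hc⟩ := hz
    exact ⟨r * c, by rw [smul_lie, hc, mul_smul]⟩

theorem gen_d_mem_rootSpace_zero (T : AffineType) : T.gen .d ∈ T.rootSpace 0 := by
  refine ⟨fun i => ?_, ?_⟩
  · rw [← lie_skew, lie_gen_d_h]; simp
  · simp

theorem gen_h_mem_rootSpace_zero (T : AffineType) (i : T.Vertex) :
    T.gen (.h i) ∈ T.rootSpace 0 := by
  refine ⟨fun j => ?_, ?_⟩
  · rw [lie_gen_h_h]; simp
  · rw [lie_gen_d_h]; simp

/-- Triangular decomposition (without directness). -/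
theorem mem_triangular (T : AffineType) (x : T.KacMoody) :
    x ∈ nestedSpan (fun i => T.gen (.e i)) ⊔ T.cartanSpan
      ⊔ nestedSpan (fun i => T.gen (.f i)) := by
  set P := nestedSpan (fun i => T.gen (.e i)) with hP
  set N := nestedSpan (fun i => T.gen (.f i)) with hN
  have hPh : ∀ z ∈ T.cartanSpan, ∀ j, ∃ c : ℂ, ⁅z, T.gen (.e j)⁆ = c • T.gen (.e j) :=
    fun z hz j => T.lie_cartanSpan (T.gen_e_mem_rootSpace j) z hz
  have hNh : ∀ z ∈ T.cartanSpan, ∀ j, ∃ c : ℂ, ⁅z, T.gen (.f j)⁆ = c • T.gen (.f j) :=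
    fun z hz j => T.lie_cartanSpan (T.gen_f_mem_rootSpace j) z hz
  have hPm : ∀ j, T.gen (.e j) ∈ P := fun j => Submodule.subset_span ⟨_, .base j⟩
  have hNm : ∀ j, T.gen (.f j) ∈ N := fun j => Submodule.subset_span ⟨_, .base j⟩
  have hHH : ∀ y ∈ T.cartanSpan, ∀ z ∈ T.cartanSpan, ⁅y, z⁆ ∈ T.cartanSpan := by
    intro y hy z hz
    have hle : T.cartanSpan ≤ T.cartanSpan.comap (LieAlgebra.ad ℂ _ y) := by
      conv_lhs => rw [cartanSpan]
      rw [Submodule.span_le]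
      rintro z (rfl | ⟨i, rfl⟩)
      · obtain ⟨c, hc⟩ := T.lie_cartanSpan T.gen_d_mem_rootSpace_zero y hy
        change ⁅y, T.gen .d⁆ ∈ T.cartanSpan
        rw [hc]
        exact Submodule.smul_mem _ _ T.gen_d_mem_cartanSpan
      · obtain ⟨c, hc⟩ := T.lie_cartanSpan (T.gen_h_mem_rootSpace_zero i) y hy
        change ⁅y, T.gen (.h i)⁆ ∈ T.cartanSpan
        rw [hc]
        exact Submodule.smul_mem _ _ (T.gen_h_mem_cartanSpan i)
    exact hle hz
  have hcl : ∀ g : T.Gen, ∀ y ∈ P ⊔ T.cartanSpan ⊔ N, ⁅T.gen g, y⁆ ∈ P ⊔ T.cartanSpan ⊔ N := by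
    intro g y hy
    obtain ⟨ab, hab, c, hc, rfl⟩ := Submodule.mem_sup.1 hy
    obtain ⟨a, ha, b, hb, rfl⟩ := Submodule.mem_sup.1 hab
    rw [lie_add, lie_add]
    have hPle : P ≤ P ⊔ T.cartanSpan ⊔ N := le_sup_left.trans le_sup_left
    have hHle : T.cartanSpan ≤ P ⊔ T.cartanSpan ⊔ N := le_sup_right.trans le_sup_left
    have hNle : N ≤ P ⊔ T.cartanSpan ⊔ N := le_sup_right
    have hNHle : N ⊔ T.cartanSpan ≤ P ⊔ T.cartanSpan ⊔ N := sup_le hNle hHle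
    have hcartan : ∀ z ∈ T.cartanSpan, ⁅z, a⁆ + ⁅z, b⁆ + ⁅z, c⁆ ∈ P ⊔ T.cartanSpan ⊔ N :=
      fun z hz => add_mem (add_mem (hPle (lie_mem_nestedSpan_of_eigen (hPh z hz) ha))
        (hHle (hHH z hz b hb))) (hNle (lie_mem_nestedSpan_of_eigen (hNh z hz) hc))
    cases g with
    | e j =>
      refine add_mem (add_mem (hPle (lie_mem_nestedSpan _ j ha)) (hPle ?_)) (hNHle ?_)
      · obtain ⟨r, hr⟩ := hPh b hb j
        rw [← lie_skew, hr]
        exact neg_mem (Submodule.smul_mem _ _ (hPm j))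
      · exact T.chevalleyRelations_gen.lie_e_mem_sup T.gen_h_mem_cartanSpan hNh j hc
    | f j =>
      refine add_mem (add_mem (le_sup_left (a := P ⊔ T.cartanSpan) ?_) (hNle ?_))
        (hNle (lie_mem_nestedSpan _ j hc))
      · exact T.chevalleyRelations_gen.swap.lie_e_mem_sup
          (fun i => neg_mem (T.gen_h_mem_cartanSpan i)) hPh j ha
      · obtain ⟨r, hr⟩ := hNh b hb j
        rw [← lie_skew, hr]
        exact neg_mem (Submodule.smul_mem _ _ (hNm j))
    | h j => exact hcartan _ (T.gen_h_mem_cartanSpan j)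
    | d => exact hcartan _ T.gen_d_mem_cartanSpan
  let S : LieSubalgebra ℂ T.KacMoody :=
    { carrier := {z | ∀ y ∈ P ⊔ T.cartanSpan ⊔ N, ⁅z, y⁆ ∈ P ⊔ T.cartanSpan ⊔ N}
      zero_mem' := fun y _ => by rw [zero_lie]; exact zero_mem _
      add_mem' := fun {z w} hz hw y hy => by rw [add_lie]; exact add_mem (hz y hy) (hw y hy)
      smul_mem' := fun c z hz y hy => by
        rw [smul_lie]; exact Submodule.smul_mem _ _ (hz y hy)
      lie_mem' := fun {z w} hz hw y hy => by
        rw [lie_lie]; exact sub_mem (hz _ (hw y hy)) (hw _ (hz y hy)) }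
  have hS : ∀ z, z ∈ S := mem_of_forall_gen_mem S hcl
  let U : LieSubalgebra ℂ T.KacMoody :=
    { P ⊔ T.cartanSpan ⊔ N with lie_mem' := fun {z w} _ hw => hS z w hw }
  refine mem_of_forall_gen_mem U (fun g => ?_) x
  change T.gen g ∈ P ⊔ T.cartanSpan ⊔ N
  cases g with
  | e j => exact Submodule.mem_sup_left (Submodule.mem_sup_left (hPm j))
  | f j => exact Submodule.mem_sup_right (hNm j)
  | h j => exact Submodule.mem_sup_left (Submodule.mem_sup_right (T.gen_h_mem_cartanSpan j))
  | d => exact Submodule.mem_sup_left (Submodule.mem_sup_right T.gen_d_mem_cartanSpan)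

/-- The Cartan operators `ad h_i` and `ad d`, indexed by `some i` and `none`. -/
noncomputable def cartanOp (T : AffineType) : Option T.Vertex → Module.End ℂ T.KacMoody
  | some i => LieAlgebra.ad ℂ _ (T.gen (.h i))
  | none => LieAlgebra.ad ℂ _ (T.gen .d)

/-- The eigenvalues of the Cartan operators on the root space of `m`. -/
noncomputable def weight (T : AffineType) (m : T.RootLattice) : Option T.Vertex → ℂ
  | some i => (T.coroot i m : ℂ)
  | none => (m 0 : ℂ)

theorem weight_injective (T : AffineType) : Function.Injective T.weight := by
  intro m m' h
  rw [← sub_eq_zero]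
  refine T.eq_zero_of_coroot_eq_zero (fun i => ?_) ?_
  · have : (T.coroot i m : ℂ) = T.coroot i m' := congrFun h (some i)
    rw [map_sub, sub_eq_zero]
    exact_mod_cast this
  · have : (m 0 : ℂ) = m' 0 := congrFun h none
    rw [Pi.sub_apply, sub_eq_zero]
    exact_mod_cast this

theorem cartanOp_commute (T : AffineType) (a b : Option T.Vertex) :
    Commute (T.cartanOp a) (T.cartanOp b) := by
  have key : ∀ x y : T.KacMoody, ⁅x, y⁆ = 0 →
      Commute (LieAlgebra.ad ℂ _ x) (LieAlgebra.ad ℂ _ y) := fun x y h =>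
    LinearMap.ext fun z => by
      rw [Module.End.mul_apply, Module.End.mul_apply]
      simp only [LieAlgebra.ad_apply]
      rw [leibniz_lie, h, zero_lie, zero_add]
  rcases a with _ | i <;> rcases b with _ | j
  · exact Commute.refl _
  · exact key _ _ (T.lie_gen_d_h j)
  · exact (key _ _ (T.lie_gen_d_h i)).symm
  · exact key _ _ (T.lie_gen_h_h i j)

/-- The simultaneous generalized eigenspace containing the root space of `m`. -/
theorem rootSpace_subset (T : AffineType) (m : T.RootLattice) {x : T.KacMoody}
    (hx : x ∈ T.rootSpace m) :
    x ∈ ⨅ a, (T.cartanOp a).maxGenEigenspace (T.weight m a) := by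
  rw [Submodule.mem_iInf]
  intro a
  refine Module.End.mem_maxGenEigenspace _ _ _ |>.2 ⟨1, ?_⟩
  rw [pow_one]
  rcases a with _ | i
  · simp [cartanOp, weight, hx.2]
  · simp [cartanOp, weight, hx.1 i]

/-- Linear independence of the root spaces: a root vector which is a combination of root vectors
for other weights vanishes. -/
theorem eq_zero_of_mem_span_rootSpace (T : AffineType) {m : T.RootLattice} {x : T.KacMoody}
    (hx : x ∈ T.rootSpace m) (hs : x ∈ Submodule.span ℂ {y | ∃ m', m' ≠ m ∧ y ∈ T.rootSpace m'}) :
    x = 0 := by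
  have hind := Module.End.independent_iInf_maxGenEigenspace_of_forall_mapsTo T.cartanOp
    fun a b φ => Module.End.mapsTo_maxGenEigenspace_of_comm (T.cartanOp_commute b a) φ
  have hdis := hind (T.weight m)
  refine Submodule.disjoint_def.1 hdis x (T.rootSpace_subset m hx) ?_
  refine (Submodule.span_le.2 ?_) hs
  rintro y ⟨m', hm', hy⟩
  exact Submodule.mem_iSup_of_mem (T.weight m') (Submodule.mem_iSup_of_mem
    (fun h => hm' (T.weight_injective h)) (T.rootSpace_subset m' hy))

/-- Every root space is met by an iterated bracket of the `e_i`, or by one of the `f_i`. -/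
theorem exists_nestedBracket (T : AffineType) {m : T.RootLattice} (hm : m ∈ T.roots) :
    (∃ x, NestedBracket (fun i => T.gen (.e i)) m x ∧ x ≠ 0) ∨
      (∃ x, NestedBracket (fun i => T.gen (.f i)) (-m) x ∧ x ≠ 0) := by
  obtain ⟨hm0, x, hx, hx0⟩ := hm
  by_contra! hcon
  refine hx0 (T.eq_zero_of_mem_span_rootSpace hx ?_)
  revert x
  suffices hle : nestedSpan (fun i => T.gen (.e i)) ⊔ T.cartanSpan
      ⊔ nestedSpan (fun i => T.gen (.f i))
      ≤ Submodule.span ℂ {y | ∃ m', m' ≠ m ∧ y ∈ T.rootSpace m'} from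
    fun x _ _ => hle (T.mem_triangular x)
  refine sup_le (sup_le ?_ ?_) ?_
  · rw [nestedSpan, Submodule.span_le]
    rintro y ⟨m', hy⟩
    by_cases h : m' = m
    · subst h
      rw [hcon.1 y hy]
      exact zero_mem _
    · exact Submodule.subset_span ⟨m', h, T.nestedBracket_e_mem_rootSpace hy⟩
  · rw [cartanSpan, Submodule.span_le]
    rintro y (rfl | ⟨i, rfl⟩)
    · exact Submodule.subset_span ⟨0, hm0.symm, T.gen_d_mem_rootSpace_zero⟩
    · exact Submodule.subset_span ⟨0, hm0.symm, T.gen_h_mem_rootSpace_zero i⟩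
  · rw [nestedSpan, Submodule.span_le]
    rintro y ⟨m', hy⟩
    by_cases h : -m' = m
    · subst h
      rw [neg_neg] at hcon
      rw [hcon.2 y hy]
      exact zero_mem _
    · exact Submodule.subset_span ⟨-m', h, T.nestedBracket_f_mem_rootSpace hy⟩

/-- The coordinates of a root all have the same sign. -/
theorem nonneg_or_nonpos_of_mem_roots (T : AffineType) {m : T.RootLattice} (hm : m ∈ T.roots) :
    (∀ i, 0 ≤ m i) ∨ (∀ i, m i ≤ 0) := by
  rcases T.exists_nestedBracket hm with ⟨x, hx, -⟩ | ⟨x, hx, -⟩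
  · exact Or.inl hx.nonneg
  · exact Or.inr fun i => by simpa using hx.nonneg i

/-- The only positive root proportional to `α_i` is `α_i`. -/
theorem eq_simpleRoot_of_mem_posRoots (T : AffineType) {m : T.RootLattice} (hm : m ∈ T.posRoots)
    {i : T.Vertex} (hi : ∀ j, j ≠ i → m j = 0) : m = T.simpleRoot i := by
  rcases T.exists_nestedBracket hm.1 with ⟨x, hx, hx0⟩ | ⟨x, hx, -⟩
  · exact ((hx.eq_zero_or_eq_single hi).resolve_left hx0).2
  · refine absurd (funext fun j => le_antisymm ?_ (hm.2 j)) hm.1.1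
    simpa using hx.nonneg j

theorem simpleRoot_mem_roots (T : AffineType) (i : T.Vertex) : T.simpleRoot i ∈ T.roots :=
  ⟨by simp [simpleRoot], _, T.gen_e_mem_rootSpace i, (T.isSl2Triple_gen i).e_ne_zero⟩

theorem ad_pow_mem_rootSpace (T : AffineType) {m m' : T.RootLattice} {x y : T.KacMoody}
    (hx : x ∈ T.rootSpace m') (hy : y ∈ T.rootSpace m) (n : ℕ) :
    (LieAlgebra.ad ℂ _ x ^ n) y ∈ T.rootSpace (m + (n : ℤ) • m') := by
  induction n with
  | zero => simpa using hy
  | succ n ih =>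
    rw [pow_succ', Module.End.mul_apply, LieAlgebra.ad_apply]
    have : m + ((n + 1 : ℕ) : ℤ) • m' = m' + (m + (n : ℤ) • m') := by
      push_cast
      module
    rw [this]
    exact T.lie_mem_rootSpace hx ih

/-- In a module over `sl₂`, a nonzero vector of weight `p ≥ 0` on which `e` is nilpotent gives,
after raising it to a primitive vector and lowering that one, a nonzero vector of weight `-p`. -/
theorem _root_.IsSl2Triple.exists_pow_ne_zero {L : Type*} [LieRing L] [LieAlgebra ℂ L]
    {h e f : L} (t : IsSl2Triple h e f) {x : L} (hx : x ≠ 0) {p : ℕ} (hp : ⁅h, x⁆ = (p : ℂ) • x)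
    (hn : ∃ n : ℕ, (LieAlgebra.ad ℂ L e ^ n) x = 0) :
    ∃ r : ℕ, (LieAlgebra.ad ℂ L f ^ (p + r)) ((LieAlgebra.ad ℂ L e ^ r) x) ≠ 0 := by
  obtain ⟨r, hr, hr'⟩ := Nat.exists_not_and_succ_of_not_zero_of_exists
    (p := fun n => (LieAlgebra.ad ℂ L e ^ n) x = 0) hx hn
  have hw : ∀ n : ℕ, ⁅h, (LieAlgebra.ad ℂ L e ^ n) x⁆
      = ((p + 2 * n : ℕ) : ℂ) • (LieAlgebra.ad ℂ L e ^ n) x := by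
    intro n
    induction n with
    | zero => simpa using hp
    | succ n ih =>
      rw [pow_succ', Module.End.mul_apply, LieAlgebra.ad_apply, leibniz_lie, ih,
        t.lie_h_e_smul ℂ, smul_lie, lie_smul, ← add_smul]
      congr 1
      push_cast
      ring
  have P : t.HasPrimitiveVectorWith ((LieAlgebra.ad ℂ L e ^ r) x) ((p + 2 * r : ℕ) : ℂ) :=
    { ne_zero := hr
      lie_h := hw r
      lie_e := by rw [pow_succ', Module.End.mul_apply, LieAlgebra.ad_apply] at hr'; exact hr' }
  exact ⟨r, P.pow_toEnd_f_ne_zero_of_eq_nat rfl (by omega)⟩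

/-- The set of roots is stable under the simple reflections. -/
theorem simpleReflection_mem_roots (T : AffineType) (i : T.Vertex) {m : T.RootLattice}
    (hm : m ∈ T.roots) : T.simpleReflection i m ∈ T.roots := by
  obtain ⟨hm0, x, hx, hx0⟩ := hm
  refine ⟨fun h => hm0 ((map_eq_zero_iff _ (T.simpleReflection i).injective).1 h), ?_⟩
  rw [simpleReflection_apply]
  have t := T.isSl2Triple_gen i
  rcases le_total 0 (T.coroot i m) with hp | hp
  · obtain ⟨p, hp⟩ := Int.eq_ofNat_of_zero_le hp
    obtain ⟨r, hr⟩ := t.exists_pow_ne_zero hx0 (p := p) (by rw [hx.1, hp]; norm_cast)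
      (T.ad_gen_e_nilpotent i x)
    refine ⟨_, ?_, hr⟩
    have hw : m - T.coroot i m • T.simpleRoot i
        = m + (r : ℤ) • T.simpleRoot i + ((p + r : ℕ) : ℤ) • -T.simpleRoot i := by
      rw [hp]
      push_cast
      module
    rw [hw]
    exact T.ad_pow_mem_rootSpace (T.gen_f_mem_rootSpace i)
      (T.ad_pow_mem_rootSpace (T.gen_e_mem_rootSpace i) hx r) (p + r)
  · obtain ⟨p, hp⟩ := Int.eq_ofNat_of_zero_le (neg_nonneg.2 hp)
    have hp' : T.coroot i m = -(p : ℤ) := by omega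
    obtain ⟨r, hr⟩ := t.symm.exists_pow_ne_zero hx0 (p := p)
      (by rw [neg_lie, hx.1, hp']; push_cast; rw [neg_smul, neg_neg]) (T.ad_gen_f_nilpotent i x)
    refine ⟨_, ?_, hr⟩
    have hw : m - T.coroot i m • T.simpleRoot i
        = m + (r : ℤ) • -T.simpleRoot i + ((p + r : ℕ) : ℤ) • T.simpleRoot i := by
      rw [hp']
      push_cast
      module
    rw [hw]
    exact T.ad_pow_mem_rootSpace (T.gen_e_mem_rootSpace i)
      (T.ad_pow_mem_rootSpace (T.gen_f_mem_rootSpace i) hx r) (p + r)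

theorem simpleOrbit_subset_roots (T : AffineType) : T.simpleOrbit ⊆ T.roots := by
  rintro _ ⟨w, hw, i, rfl⟩
  exact T.weylGroup_induction (P := fun m => m ∈ T.roots)
    (fun i _ hm => T.simpleReflection_mem_roots i hm) hw _ (T.simpleRoot_mem_roots i)

theorem mem_simpleOrbit_or_coroot_eq_zero_aux (T : AffineType) (n : ℕ) :
    ∀ m ∈ T.posRoots, ∑ i, m i ≤ n → m ∈ T.simpleOrbit ∨ ∀ i, T.coroot i m = 0 := by
  induction n with
  | zero =>
    intro m hm hsum
    have hz := (Finset.sum_eq_zero_iff_of_nonneg fun i _ => hm.2 i).1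
      (le_antisymm hsum (Finset.sum_nonneg fun i _ => hm.2 i))
    exact absurd (funext fun i => hz i (Finset.mem_univ i)) hm.1.1
  | succ n ih =>
    intro m hm hsum
    by_cases hle : ∀ i, T.coroot i m ≤ 0
    · exact Or.inr (T.coroot_eq_zero_of_nonpos hle)
    push Not at hle
    obtain ⟨i, hi⟩ := hle
    have hr := T.simpleReflection_mem_roots i hm.1
    rcases T.nonneg_or_nonpos_of_mem_roots hr with h | h
    · have hsum' : ∑ j, T.simpleReflection i m j ≤ n := by
        have : ∑ j, T.simpleReflection i m j = ∑ j, m j - T.coroot i m := by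
          simp [simpleReflection_apply, Finset.sum_sub_distrib, ← Finset.mul_sum, simpleRoot]
        push_cast at hsum
        omega
      rcases ih _ ⟨hr, h⟩ hsum' with ho | hc
      · left
        have := T.map_mem_simpleOrbit (T.simpleReflection_mem_weylGroup i) ho
        rwa [T.simpleReflection_involutive i m] at this
      · right
        have hfix : T.simpleReflection i (T.simpleReflection i m) = T.simpleReflection i m := by
          rw [T.simpleReflection_apply i (T.simpleReflection i m), hc i, zero_smul, sub_zero]
        rw [T.simpleReflection_involutive i m] at hfix
        rwa [← hfix] at hc
    · left
      rw [T.eq_simpleRoot_of_mem_posRoots (i := i) hm fun j hj => ?_]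
      · exact T.simpleRoot_mem_simpleOrbit i
      · have := h j
        rw [simpleReflection_apply] at this
        simp only [Pi.sub_apply, Pi.smul_apply, simpleRoot, Pi.single_eq_of_ne hj, smul_zero,
          sub_zero] at this
        exact le_antisymm this (hm.2 j)

/-- A positive root is real or annihilated by all coroots. -/
theorem mem_simpleOrbit_or_coroot_eq_zero (T : AffineType) {m : T.RootLattice}
    (hm : m ∈ T.posRoots) : m ∈ T.simpleOrbit ∨ ∀ i, T.coroot i m = 0 :=
  T.mem_simpleOrbit_or_coroot_eq_zero_aux (∑ i, m i).toNat m hm (Int.self_le_toNat _)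

/-! ### The cone of an involution -/

theorem htSigma_add (T : AffineType) (s : T.Vertex → ℕ) (m m' : T.RootLattice) :
    T.htSigma s (m + m') = T.htSigma s m + T.htSigma s m' := by
  simp [htSigma, mul_add, Finset.sum_add_distrib]

theorem htSigma_zsmul (T : AffineType) (s : T.Vertex → ℕ) (c : ℤ) (m : T.RootLattice) :
    T.htSigma s (c • m) = c * T.htSigma s m := by
  simp only [htSigma, Pi.smul_apply, smul_eq_mul, Finset.mul_sum]
  exact Finset.sum_congr rfl fun i _ => by ring

theorem htSigma_neg (T : AffineType) (s : T.Vertex → ℕ) (m : T.RootLattice) :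
    T.htSigma s (-m) = -T.htSigma s m := by
  simp [htSigma]

theorem htSigma_nonneg (T : AffineType) (s : T.Vertex → ℕ) {m : T.RootLattice}
    (hm : ∀ i, 0 ≤ m i) : 0 ≤ T.htSigma s m :=
  Finset.sum_nonneg fun i _ => mul_nonneg (Int.natCast_nonneg _) (hm i)

theorem k_mul_htSigma_delta (T : AffineType) {s : T.Vertex → ℕ}
    (h : T.k * ∑ i, T.label i * s i = 2) : (T.k : ℤ) * T.htSigma s T.delta = 2 := by
  have : T.htSigma s T.delta = ((∑ i, T.label i * s i : ℕ) : ℤ) := by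
    simp [htSigma, delta, mul_comm]
  rw [this]
  exact_mod_cast h

theorem k_eq_one_or_two (T : AffineType) {s : T.Vertex → ℕ}
    (h : T.k * ∑ i, T.label i * s i = 2) : T.k = 1 ∨ T.k = 2 :=
  (Nat.dvd_prime Nat.prime_two).1 ⟨_, h.symm⟩

theorem epsilon_le_k (T : AffineType) {s : T.Vertex → ℕ}
    (h : T.k * ∑ i, T.label i * s i = 2) (i : T.Vertex) : T.epsilon i ≤ T.k := by
  unfold epsilon
  rcases T.k_eq_one_or_two h with hk | hk <;> split_ifs <;> simp_all

theorem epsilon_pos (T : AffineType) (i : T.Vertex) : 0 < T.epsilon i := by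
  unfold epsilon
  split_ifs <;> norm_num

/-- If `k = 2`, `α_i` is not long and `a_i = 1`, then `a_i^∨ = 1`, because the square lengths
`2 a_j^∨ / a_j` of the simple roots are at most `4`. -/
theorem colabel_eq_one_of_not_mem_longRoots (T : AffineType) (hk : T.k = 2) {i : T.Vertex}
    (hi : T.label i = 1) (hlong : T.simpleRoot i ∉ T.longRoots) : T.colabel i = 1 := by
  have hreal : T.simpleRoot i ∈ T.realRoots :=
    ⟨T.simpleRoot_mem_roots i, 1, one_mem _, i, rfl⟩
  have hex : ∃ b ∈ T.realRoots, T.latticeForm (T.simpleRoot i) (T.simpleRoot i)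
      < T.latticeForm b b := by
    by_contra! hcon
    exact hlong ⟨hreal, hcon⟩
  obtain ⟨b, ⟨-, w, hw, j, rfl⟩, hlt⟩ := hex
  rw [latticeForm_weylGroup T hw, latticeForm_simpleRoot_self, latticeForm_simpleRoot_self] at hlt
  have h1 : T.halfNorm i = T.colabel i := by
    rw [← label_mul_halfNorm, hi, Nat.cast_one, one_mul]
  have h2 : T.halfNorm j ≤ 2 := by
    have := Nat.le_of_dvd (Nat.mul_pos (by omega) (T.label_pos j)) (T.colabel_dvd j)
    rw [hk] at this
    rw [halfNorm, div_le_iff₀ (Nat.cast_pos.2 (T.label_pos j))]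
    exact_mod_cast this
  have h3 : (T.colabel i : ℝ) < 2 := by linarith
  have h4 : T.colabel i < 2 := by exact_mod_cast h3
  have := T.colabel_pos i
  omega

/-- The vectors `α_i + ε_i s_i δ` are real roots. -/
theorem simpleRoot_add_epsilon_mem_simpleOrbit (T : AffineType) {s : T.Vertex → ℕ}
    (h : T.k * ∑ i, T.label i * s i = 2) (i : T.Vertex) :
    T.simpleRoot i + (T.epsilon i * s i) • T.delta ∈ T.simpleOrbit := by
  have hd := T.colabel_dvd i
  suffices hdvd : T.colabel i ∣ T.epsilon i * s i * T.label i by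
    have := T.simpleRoot_add_mem_simpleOrbit i ((T.epsilon i * s i : ℕ) : ℤ)
      (by exact_mod_cast hdvd)
    rwa [natCast_zsmul] at this
  unfold epsilon
  split_ifs with hc
  · rw [one_mul]
    rcases T.k_eq_one_or_two h with hk | hk
    · rw [hk, one_mul] at hd
      exact hd.mul_left _
    · have hsum : ∑ i, T.label i * s i = 1 := by
        rw [hk] at h
        omega
      have hle : T.label i * s i ≤ 1 := hsum ▸ Finset.single_le_sum
        (f := fun i => T.label i * s i) (fun _ _ => Nat.zero_le _) (Finset.mem_univ i)
      rcases Nat.eq_zero_or_pos (s i) with hs | hs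
      · simp [hs]
      · have hl : T.label i = 1 := le_antisymm
          ((Nat.le_mul_of_pos_right _ hs).trans hle) (T.label_pos i)
        rw [T.colabel_eq_one_of_not_mem_longRoots hk hl (hc.resolve_left (by omega))]
        exact one_dvd _
  · have hk : T.k = 2 := (T.k_eq_one_or_two h).resolve_left fun hk => hc (Or.inl hk)
    rw [hk] at hd
    rw [mul_right_comm]
    exact hd.mul_right _

theorem exists_eq_mul_label (T : AffineType) {m : T.RootLattice}
    (h : ∀ i, T.coroot i m = 0) : ∃ c : ℝ, ∀ i, (m i : ℝ) = c * T.label i := by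
  have hz : T.latticeForm m m = 0 := by simp [latticeForm_eq_sum_coroot, h]
  refine ⟨(m 0 : ℝ) / T.label 0, fun i => ?_⟩
  rw [T.ratio_eq_of_latticeForm_self_eq_zero hz 0 i]
  exact (div_mul_cancel₀ _ (Nat.cast_ne_zero.2 (T.label_pos i).ne')).symm

/-- The roots of `σ`-height zero are real: a multiple of `δ` has nonzero height. -/
theorem mem_simpleOrbit_of_mem_posRootsZero (T : AffineType) {s : T.Vertex → ℕ}
    (h : T.k * ∑ i, T.label i * s i = 2) {m : T.RootLattice} (hm : m ∈ T.posRootsZero s) :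
    m ∈ T.simpleOrbit := by
  refine (T.mem_simpleOrbit_or_coroot_eq_zero hm.1).resolve_right fun hc => ?_
  obtain ⟨c, hc⟩ := T.exists_eq_mul_label hc
  have h1 : (T.htSigma s m : ℝ) = c * T.htSigma s T.delta := by
    simp only [htSigma, Int.cast_sum, Int.cast_mul, hc, delta, Finset.mul_sum]
    exact Finset.sum_congr rfl fun i _ => by push_cast; ring
  have h2 : T.htSigma s T.delta ≠ 0 := by
    intro h0
    have := T.k_mul_htSigma_delta h
    rw [h0] at this
    omega
  rw [hm.2, Int.cast_zero, eq_comm, mul_eq_zero] at h1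
  have hc0 : c = 0 := h1.resolve_right (Int.cast_ne_zero.2 h2)
  exact hm.1.1.1 (funext fun i => by simpa [hc0] using hc i)

theorem mem_posRoots_of_htSigma_pos (T : AffineType) {s : T.Vertex → ℕ} {m : T.RootLattice}
    (hm : m ∈ T.roots) (hpos : 0 < T.htSigma s m) : m ∈ T.posRoots := by
  refine ⟨hm, (T.nonneg_or_nonpos_of_mem_roots hm).resolve_right fun hneg => ?_⟩
  have := T.htSigma_nonneg s (m := -m) fun i => by simpa using hneg i
  rw [htSigma_neg] at this
  omega

theorem k_smul_delta_sub_mem_posRoots (T : AffineType) {s : T.Vertex → ℕ}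
    (h : T.k * ∑ i, T.label i * s i = 2) {g : T.RootLattice} (hg : g ∈ T.posRootsZero s) :
    T.k • T.delta - g ∈ T.posRoots := by
  have hk := T.k_mul_htSigma_delta h
  have hmem := T.add_zsmul_k_delta_mem_simpleOrbit
    (T.neg_mem_simpleOrbit (T.mem_simpleOrbit_of_mem_posRootsZero h hg)) 1
  have he : -g + (1 * (T.k : ℤ)) • T.delta = T.k • T.delta - g := by
    rw [one_mul, natCast_zsmul]
    abel
  refine T.mem_posRoots_of_htSigma_pos (s := s) (he ▸ T.simpleOrbit_subset_roots hmem) ?_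
  rw [← he, htSigma_add, htSigma_neg, htSigma_zsmul, hg.2, one_mul, hk]
  norm_num

theorem phiSigma_subset_posRoots (T : AffineType) {s : T.Vertex → ℕ}
    (h : T.k * ∑ i, T.label i * s i = 2) : T.PhiSigma s ⊆ T.posRoots := by
  rintro m (⟨i, rfl⟩ | ⟨g, hg, rfl⟩)
  · refine ⟨T.simpleOrbit_subset_roots (T.simpleRoot_add_epsilon_mem_simpleOrbit h i),
      fun j => add_nonneg ?_ (nsmul_nonneg ?_ _)⟩
    · exact (Pi.single_nonneg.2 zero_le_one : (0 : T.RootLattice) ≤ T.simpleRoot i) j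
    · exact Int.natCast_nonneg _
  · exact T.k_smul_delta_sub_mem_posRoots h hg.1

/-- No element of `Φ_σ` has `σ`-height one. -/
theorem htSigma_ne_one_of_mem_phiSigma (T : AffineType) {s : T.Vertex → ℕ}
    (h : T.k * ∑ i, T.label i * s i = 2) {m : T.RootLattice} (hm : m ∈ T.PhiSigma s) :
    T.htSigma s m ≠ 1 := by
  have hk := T.k_mul_htSigma_delta h
  rcases hm with ⟨i, rfl⟩ | ⟨g, hg, rfl⟩
  · have hs : T.htSigma s (T.simpleRoot i) = s i := by
      simp [htSigma, simpleRoot, Pi.single_apply]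
    rw [htSigma_add, ← natCast_zsmul, htSigma_zsmul, hs]
    have hδ : 0 < T.htSigma s T.delta := by
      by_contra! hle
      have : (T.k : ℤ) * T.htSigma s T.delta ≤ 0 :=
        mul_nonpos_of_nonneg_of_nonpos (Int.natCast_nonneg _) hle
      omega
    have he := T.epsilon_pos i
    rcases Nat.eq_zero_or_pos (s i) with hs0 | hs0
    · simp [hs0]
    · have h1 : 0 < ((T.epsilon i * s i : ℕ) : ℤ) * T.htSigma s T.delta :=
        mul_pos (by exact_mod_cast Nat.mul_pos he hs0) hδ
      omega
  · rw [sub_eq_add_neg, htSigma_add, htSigma_neg, hg.1.2, ← natCast_zsmul, htSigma_zsmul, hk]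
    norm_num

theorem nonneg_and_htSigma_of_mem_closure (T : AffineType) (s : T.Vertex → ℕ)
    {m : T.RootLattice} (hm : m ∈ AddSubmonoid.closure (T.posRootsZero s)) :
    (∀ i, 0 ≤ m i) ∧ T.htSigma s m = 0 := by
  induction hm using AddSubmonoid.closure_induction with
  | mem x hx => exact ⟨hx.1.2, hx.2⟩
  | zero => exact ⟨fun _ => le_rfl, by simp [htSigma]⟩
  | add x y _ _ hx hy =>
    exact ⟨fun i => add_nonneg (hx.1 i) (hy.1 i), by rw [htSigma_add, hx.2, hy.2, add_zero]⟩

/-- Every root of `σ`-height zero lies below a maximal one: the roots of height zero are bounded,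
since `kδ - γ` is positive for each of them. -/
theorem exists_maxRootsZero_ge (T : AffineType) {s : T.Vertex → ℕ}
    (h : T.k * ∑ i, T.label i * s i = 2) {g : T.RootLattice} (hg : g ∈ T.posRootsZero s) :
    ∃ b ∈ T.maxRootsZero s, b - g ∈ AddSubmonoid.closure (T.posRootsZero s) := by
  set U : Set T.RootLattice :=
    {b | b ∈ T.posRootsZero s ∧ b - g ∈ AddSubmonoid.closure (T.posRootsZero s)} with hU
  have hfin : U.Finite := by
    refine (Set.finite_Icc (0 : T.RootLattice) (T.k • T.delta)).subset fun b hb =>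
      ⟨hb.1.1.2, fun i => ?_⟩
    exact sub_nonneg.1 ((T.k_smul_delta_sub_mem_posRoots h hb.1).2 i)
  obtain ⟨b, hb, hmax⟩ := hfin.exists_maximalFor (fun b => ∑ i, b i) U
    ⟨g, hg, by rw [sub_self]; exact zero_mem _⟩
  refine ⟨b, ⟨hb.1, fun c hc hcb => ?_⟩, hb.2⟩
  have hcU : c ∈ U := ⟨hc, by
    rw [← sub_add_sub_cancel c b g]
    exact add_mem hcb hb.2⟩
  have hpos := (T.nonneg_and_htSigma_of_mem_closure s hcb).1
  have hle : ∑ i, b i ≤ ∑ i, c i := Finset.sum_le_sum fun i _ => by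
    have := hpos i
    rw [Pi.sub_apply] at this
    omega
  have hge := hmax hcU hle
  have hz : ∑ i, (c - b) i = 0 := by
    simp only [Pi.sub_apply, Finset.sum_sub_distrib]
    simp only at hge
    omega
  have := (Finset.sum_eq_zero_iff_of_nonneg fun i _ => hpos i).1 hz
  exact sub_eq_zero.1 (funext fun i => this i (Finset.mem_univ i))

theorem map_eq_sum {T : AffineType} (f : T.RootLattice →+ ℝ) (m : T.RootLattice) :
    f m = ∑ i, (m i : ℝ) * f (T.simpleRoot i) := by
  have : m = ∑ i, m i • T.simpleRoot i := by
    funext j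
    simp [simpleRoot, Finset.sum_apply, Pi.single_apply]
  conv_lhs => rw [this]
  rw [map_sum]
  exact Finset.sum_congr rfl fun i _ => by rw [map_zsmul, zsmul_eq_mul]

theorem map_simpleRoot_ge {T : AffineType} {s : T.Vertex → ℕ} {f : T.RootLattice →+ ℝ}
    (hf : ∀ m ∈ T.PhiSigma s, 0 ≤ f m) (i : T.Vertex) :
    -((T.epsilon i * s i : ℕ) : ℝ) * f T.delta ≤ f (T.simpleRoot i) := by
  have := hf _ (Or.inl ⟨i, rfl⟩)
  rw [map_add, map_nsmul, nsmul_eq_mul] at this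
  linarith

/-- `f δ ≥ 0`, because `∑ a_i (α_i + ε_i s_i δ)` is a positive multiple of `δ`. -/
theorem map_delta_nonneg {T : AffineType} {s : T.Vertex → ℕ} {f : T.RootLattice →+ ℝ}
    (hf : ∀ m ∈ T.PhiSigma s, 0 ≤ f m) : 0 ≤ f T.delta := by
  have h1 : ∑ i, (T.label i : ℝ) * (-((T.epsilon i * s i : ℕ) : ℝ) * f T.delta) ≤ f T.delta := by
    rw [map_eq_sum f T.delta]
    refine Finset.sum_le_sum fun i _ => ?_
    have := map_simpleRoot_ge hf i
    rw [delta, Int.cast_natCast]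
    rw [map_eq_sum f T.delta] at this
    exact mul_le_mul_of_nonneg_left this (Nat.cast_nonneg _)
  have h2 : ∑ i, (T.label i : ℝ) * (-((T.epsilon i * s i : ℕ) : ℝ) * f T.delta)
      = -((∑ i, T.label i * (T.epsilon i * s i) : ℕ) : ℝ) * f T.delta := by
    push_cast
    rw [← Finset.sum_neg_distrib, Finset.sum_mul]
    exact Finset.sum_congr rfl fun i _ => by ring
  rw [h2] at h1
  have h3 : (0 : ℝ) ≤ ((∑ i, T.label i * (T.epsilon i * s i) : ℕ) : ℝ) := Nat.cast_nonneg _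
  by_contra! hneg
  nlinarith

/-- A nonnegative combination `m` of simple roots satisfies `f m ≥ -k ht(m) f δ`. -/
theorem map_ge_of_nonneg {T : AffineType} {s : T.Vertex → ℕ} {f : T.RootLattice →+ ℝ}
    (hf : ∀ m ∈ T.PhiSigma s, 0 ≤ f m) (h : T.k * ∑ i, T.label i * s i = 2)
    {m : T.RootLattice} (hm : ∀ i, 0 ≤ m i) :
    -((T.k : ℝ) * T.htSigma s m) * f T.delta ≤ f m := by
  have hδ := map_delta_nonneg hf
  rw [map_eq_sum f m, htSigma]
  push_cast
  rw [Finset.mul_sum, ← Finset.sum_neg_distrib, Finset.sum_mul]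
  refine Finset.sum_le_sum fun i _ => ?_
  have h0 : (0 : ℝ) ≤ m i := by exact_mod_cast hm i
  refine le_trans ?_ (mul_le_mul_of_nonneg_left (map_simpleRoot_ge hf i) h0)
  have he : (T.epsilon i : ℝ) ≤ T.k := by exact_mod_cast T.epsilon_le_k h i
  have : (T.epsilon i : ℝ) * (s i * m i * f T.delta) ≤ T.k * (s i * m i * f T.delta) :=
    mul_le_mul_of_nonneg_right he (by positivity)
  push_cast
  linarith

/-- `f ≤ k f δ` on the roots of `σ`-height zero. -/
theorem map_le_of_mem_posRootsZero {T : AffineType} {s : T.Vertex → ℕ} {f : T.RootLattice →+ ℝ}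
    (hf : ∀ m ∈ T.PhiSigma s, 0 ≤ f m) (h : T.k * ∑ i, T.label i * s i = 2)
    {g : T.RootLattice} (hg : g ∈ T.posRootsZero s) :
    f g ≤ T.k * f T.delta := by
  obtain ⟨b, hb, hbg⟩ := T.exists_maxRootsZero_ge h hg
  have h1 := hf _ (Or.inr ⟨b, hb, rfl⟩)
  rw [map_sub, map_nsmul, nsmul_eq_mul] at h1
  have h2 := T.nonneg_and_htSigma_of_mem_closure s hbg
  have h3 := map_ge_of_nonneg hf h h2.1
  rw [h2.2, map_sub] at h3
  simp only [Int.cast_zero, mul_zero, neg_zero, zero_mul] at h3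
  linarith

/-- An additive functional that is nonnegative on `Φ_σ` is nonnegative on all positive roots of
`σ`-height different from one. -/
theorem map_nonneg_of_mem_posRoots {T : AffineType} {s : T.Vertex → ℕ} {f : T.RootLattice →+ ℝ}
    (hf : ∀ m ∈ T.PhiSigma s, 0 ≤ f m) (h : T.k * ∑ i, T.label i * s i = 2)
    {a : T.RootLattice} (ha : a ∈ T.posRoots)
    (hht : T.htSigma s a ≠ 1) : 0 ≤ f a := by
  have hδ := map_delta_nonneg hf
  rcases T.mem_simpleOrbit_or_coroot_eq_zero ha with hreal | him
  · have hnn := T.htSigma_nonneg s ha.2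
    obtain ⟨r, hr⟩ : ∃ r : ℤ, r = T.htSigma s a / 2 := ⟨_, rfl⟩
    obtain ⟨b, hb⟩ : ∃ b, b = a + (-r * T.k) • T.delta := ⟨_, rfl⟩
    have hbroot : b ∈ T.roots :=
      hb ▸ T.simpleOrbit_subset_roots (T.add_zsmul_k_delta_mem_simpleOrbit hreal (-r))
    have hbht : T.htSigma s b = T.htSigma s a - 2 * r := by
      rw [hb, htSigma_add, htSigma_zsmul, mul_assoc, T.k_mul_htSigma_delta h]
      ring
    have hfb : f a = f b + r * (T.k * f T.delta) := by
      rw [hb, map_add, map_zsmul, zsmul_eq_mul]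
      push_cast
      ring
    have hkδ : 0 ≤ (T.k : ℝ) * f T.delta := mul_nonneg (Nat.cast_nonneg _) hδ
    have hr0 : (0 : ℝ) ≤ r := by exact_mod_cast (by omega : 0 ≤ r)
    rw [hfb]
    rcases T.nonneg_or_nonpos_of_mem_roots hbroot with hpos | hneg
    · have h1 := map_ge_of_nonneg hf h hpos
      -- the height of `b` is `0`, or it is `1` and then `r ≥ 1`
      have h2 : T.htSigma s b ≤ r := by omega
      have h3 : (T.htSigma s b : ℝ) ≤ r := by exact_mod_cast h2
      have h4 := mul_le_mul_of_nonneg_right h3 hkδ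
      linarith
    · have hneg' : ∀ i, 0 ≤ (-b) i := fun i => by simpa using hneg i
      have h1 := T.htSigma_nonneg s hneg'
      rw [htSigma_neg] at h1
      have h0 : T.htSigma s b = 0 := by omega
      have hbroot' : -b ∈ T.roots := by
        refine T.simpleOrbit_subset_roots (T.neg_mem_simpleOrbit ?_)
        exact hb ▸ T.add_zsmul_k_delta_mem_simpleOrbit hreal (-r)
      have h2 := map_le_of_mem_posRootsZero hf h
        (g := -b) ⟨⟨hbroot', hneg'⟩, by rw [htSigma_neg, h0, neg_zero]⟩
      rw [map_neg] at h2
      have hr1 : 1 ≤ r := by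
        -- for `r = 0` the positive root `a` would equal `b`
        by_contra! hlt
        have : r = 0 := by omega
        rw [this, neg_zero, zero_mul, zero_smul, add_zero] at hb
        subst hb
        exact hbroot.1 (funext fun i => le_antisymm (hneg i) (ha.2 i))
      have hr1' : (1 : ℝ) ≤ r := by exact_mod_cast hr1
      have := mul_le_mul_of_nonneg_right hr1' hkδ
      linarith
  · obtain ⟨c, hc⟩ := T.exists_eq_mul_label him
    have hfa : f a = c * f T.delta := by
      rw [map_eq_sum f a, map_eq_sum f T.delta, Finset.mul_sum]
      refine Finset.sum_congr rfl fun i _ => ?_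
      rw [hc, delta, Int.cast_natCast, mul_assoc]
    have hc0 : 0 ≤ c := by
      have h1 : (0 : ℝ) ≤ a 0 := by exact_mod_cast ha.2 0
      rw [hc] at h1
      exact nonneg_of_mul_nonneg_left h1 (Nat.cast_pos.2 (T.label_pos 0))
    rw [hfa]
    exact mul_nonneg hc0 hδ

/-- The functional `α ↦ (α, x)` on the root lattice, for `x ∈ ĥ_ℝ^* / ℝδ`. -/
noncomputable def pairingHom (T : AffineType) (x : T.HBar) : T.RootLattice →+ ℝ :=
  AddMonoidHom.mk' (fun m => T.pairing ⟨T.toHDual m, T.toHDual_mem_hZero m⟩ x) fun m m' => by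
    induction x using Submodule.Quotient.induction_on with
    | _ y =>
      change T.form (T.toHDual (m + m')) y = T.form (T.toHDual m) y + T.form (T.toHDual m') y
      rw [toHDual_add, map_add, LinearMap.add_apply]

theorem mem_halfSpace_iff (T : AffineType) (m : T.RootLattice) (x : T.HBar) :
    x ∈ T.halfSpace m ↔ 0 ≤ T.pairingHom x m := Iff.rfl

end AffineType

/-- Let `σ` be the involution of type `(s_0, …, s_n; k)`, so that the `s_i` are coprime nonnegative
integers with `k ∑ a_i s_i = 2`. Then `Φ_σ ⊆ Δ̂⁺`, and `C_σ` is the intersection of the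
half-spaces `Ĥ_α⁺` for `α ∈ Φ_σ`. -/
theorem proposition4p1 (T : AffineType) (s : T.Vertex → ℕ)
    (hcoprime : Finset.univ.gcd s = 1)
    (horder : T.k * ∑ i, T.label i * s i = 2) :
    T.PhiSigma s ⊆ T.posRoots ∧
      T.coneSigma s = ⋂ a ∈ T.PhiSigma s, T.halfSpace a := by
  refine ⟨T.phiSigma_subset_posRoots horder, Set.Subset.antisymm ?_ ?_⟩
  · intro x hx
    simp only [AffineType.coneSigma, Set.mem_iInter] at hx ⊢
    exact fun a ha => hx a ⟨T.phiSigma_subset_posRoots horder ha,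
      T.htSigma_ne_one_of_mem_phiSigma horder ha⟩
  · intro x hx
    simp only [AffineType.coneSigma, Set.mem_iInter, AffineType.mem_halfSpace_iff] at hx ⊢
    exact fun a ha => AffineType.map_nonneg_of_mem_posRoots hx horder ha.1 ha.2
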